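/- Let $\mathfrak g$ be the compact simple real Lie algebra of type $\mathrm E_7$, and let $B$ be the negative of its Killing form. Let $$\mathfrak g=\mathfrak k\oplus\mathfrak m_1\oplus\mathfrak m_2\oplus\mathfrak m_3,\qquad \mathfrak k=A_1^1\oplus A_1^2\oplus A_1^3\oplus D_4,$$ be a decomposition of type $\mathrm E_7$-I: $\mathfrak k$ is a subalgebra which is the direct sum of four commuting ideals $A_1^1,A_1^2,A_1^3\cong\mathfrak{su}(2)$ and $D_4\cong\mathfrak{so}(8)$; the subspaces $\mathfrak k,\mathfrak m_1,\mathfrak m_2,\mathfrak m_3$ are pairwise $B$-orthogonal; each $\mathfrak m_i$ is a nonzero irreducible $\operatorname{ad}(\mathfrak k)$-module; $[\mathfrak m_i,\mathfrak m_i]\subset\mathfrak k$ for every $i$, and $[\mathfrak m_i,\mathfrak m_j]\subset\mathfrak m_l$ for $\{i,j,l\}=\{1,2,3\}$. Write $(\mathfrak k_1,\dots,\mathfrak k_7)=(A_1^1,A_1^2,A_1^3,D_4,\mathfrak m_1,\mathfrak m_2,\mathfrak m_3)$, choose a $B$-orthonormal basis $\{e^i_\alpha\}_\alpha$ of each $\mathfrak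 k_i$, and put $$(ijk)=\sum_{\alpha,\beta,\gamma}B\big([e^i_\alpha,e^j_\beta],e^k_\gamma\big)^2 .$$ Then the three ideals of type $A_1$ can be numbered so that, for every such choice of bases, $$\begin{aligned} &(111)=(222)=(333)=\tfrac13,\quad (444)=\tfrac{28}{3},\quad (567)=\tfrac{64}{9},\\ &(166)=(177)=(255)=(277)=(355)=(366)=\tfrac43,\\ &(155)=(266)=(377)=0,\quad (455)=(466)=(477)=\tfrac{56}{9}, \end{aligned}$$ and every $(ijk)$ whose indices are not, up to order, those of one of the quantities listed here is zero. -/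

import Mathlib

open scoped TensorProduct

namespace E7I

/-- A complex Lie algebra is (semisimple) of type `E₇` if its Killing form is nondegenerate and its
root system with respect to any Cartan subalgebra has a base whose Cartan matrix is, after a
renumbering of the simple roots, the Cartan matrix of type `E₇`. (All Cartan subalgebras are
conjugate, so one may equally well test a single one.) -/
def IsTypeE7 (L : Type*) [LieRing L] [LieAlgebra ℂ L] [FiniteDimensional ℂ L] : Prop :=
  ∃ _ : LieAlgebra.IsKilling ℂ L, ∀ (H : LieSubalgebra ℂ L) [H.IsCartanSubalgebra],
    ∃ (b : (LieAlgebra.IsKilling.rootSystem H).Base) (e : b.support ≃ Fin 7),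
      ∀ i j, b.cartanMatrix i j = CartanMatrix.E₇ (e i) (e j)

section

attribute [local instance] LieRing.ofAssociativeRing

/-- The compact real Lie algebra `su(n)`: trace-free skew-Hermitian complex matrices. -/
def su (n : ℕ) : LieSubalgebra ℝ (Matrix (Fin n) (Fin n) ℂ) where
  carrier := {A | A.conjTranspose = -A ∧ A.trace = 0}
  add_mem' := by
    rintro A B ⟨hA, hA'⟩ ⟨hB, hB'⟩
    refine ⟨?_, ?_⟩
    · rw [Matrix.conjTranspose_add, hA, hB, neg_add]
    · rw [Matrix.trace_add, hA', hB', add_zero]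
  zero_mem' := by simp
  smul_mem' := by
    rintro c A ⟨hA, hA'⟩
    refine ⟨?_, ?_⟩
    · rw [Matrix.conjTranspose_smul, hA, star_trivial, smul_neg]
    · rw [Matrix.trace_smul, hA', smul_zero]
  lie_mem' := by
    rintro A B ⟨hA, -⟩ ⟨hB, -⟩
    refine ⟨?_, ?_⟩
    · rw [Ring.lie_def, Matrix.conjTranspose_sub, Matrix.conjTranspose_mul,
        Matrix.conjTranspose_mul, hA, hB]
      simp
    · rw [Ring.lie_def, Matrix.trace_sub, Matrix.trace_mul_comm, sub_self]

end

section

variable {g : Type*} [LieRing g] [LieAlgebra ℝ g]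

/-- `B`, the negative of the Killing form. -/
noncomputable def B (x y : g) : ℝ := -killingForm ℝ g x y

/-- The sum `k = A 0 + A 1 + A 2 + D` of the subalgebras `A i` and `D`. -/
def isotropy (A : Fin 3 → LieSubalgebra ℝ g) (D : LieSubalgebra ℝ g) : Submodule ℝ g :=
  (⨆ i, (A i).toSubmodule) ⊔ D.toSubmodule

/-- The decomposition of type `E₇`-I of a real Lie algebra `g`: the algebra `g` is the compact
simple Lie algebra of type `E₇`, and it is the `B`-orthogonal direct sum
`g = k ⊕ m 0 ⊕ m 1 ⊕ m 2` of a generalized Wallach space whose isotropy algebra is the direct sum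
`k = A 0 ⊕ A 1 ⊕ A 2 ⊕ D` of ideals `A i` of type `A₁` and `D` of type `D₄`. -/
structure IsDecomposition [FiniteDimensional ℝ g] (A : Fin 3 → LieSubalgebra ℝ g)
    (D : LieSubalgebra ℝ g) (m : Fin 3 → Submodule ℝ g) : Prop where
  /-- `g` is compact and semisimple. -/
  compact : ∀ x : g, x ≠ 0 → 0 < B x x
  /-- The complexification of `g` is of type `E₇`. -/
  type_E7 : IsTypeE7 (ℂ ⊗[ℝ] g)
  A_iso : ∀ i, Nonempty (A i ≃ₗ⁅ℝ⁆ su 2)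
  D_iso : Nonempty (D ≃ₗ⁅ℝ⁆ LieAlgebra.Orthogonal.so (Fin 8) ℝ)
  /-- The four summands of `k` commute with one another, so that each is an ideal of `k`. -/
  lie_A_A : ∀ i j, i ≠ j → ∀ x ∈ A i, ∀ y ∈ A j, ⁅x, y⁆ = 0
  lie_A_D : ∀ i, ∀ x ∈ A i, ∀ y ∈ D, ⁅x, y⁆ = 0
  /-- The summands span `g`, and `k`, `m 0`, `m 1`, `m 2` are pairwise orthogonal. -/
  sup_eq_top : isotropy A D ⊔ (⨆ i, m i) = ⊤
  orth_isotropy : ∀ i, ∀ x ∈ isotropy A D, ∀ y ∈ m i, B x y = 0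
  orth_m : ∀ i j, i ≠ j → ∀ x ∈ m i, ∀ y ∈ m j, B x y = 0
  /-- Each `m i` is an irreducible `ad k`-module. -/
  invariant : ∀ i, ∀ x ∈ isotropy A D, ∀ y ∈ m i, ⁅x, y⁆ ∈ m i
  ne_bot : ∀ i, m i ≠ ⊥
  irreducible : ∀ i, ∀ W : Submodule ℝ g, W ≤ m i →
    (∀ x ∈ isotropy A D, ∀ y ∈ W, ⁅x, y⁆ ∈ W) → W = ⊥ ∨ W = m i
  /-- The bracket relations of a generalized Wallach space. -/
  lie_self : ∀ i, ∀ x ∈ m i, ∀ y ∈ m i, ⁅x, y⁆ ∈ isotropy A D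
  lie_ne : ∀ i j l, i ≠ j → j ≠ l → i ≠ l → ∀ x ∈ m i, ∀ y ∈ m j, ⁅x, y⁆ ∈ m l

/-- The summands with the indices `1, …, 7` of the text; the index `0` stands for the center of
`k`, which is zero. -/
def summand (A : Fin 3 → LieSubalgebra ℝ g) (D : LieSubalgebra ℝ g)
    (m : Fin 3 → Submodule ℝ g) : Fin 8 → Submodule ℝ g :=
  ![⊥, (A 0).toSubmodule, (A 1).toSubmodule, (A 2).toSubmodule, D.toSubmodule, m 0, m 1, m 2]

/-- `e` is a `B`-orthonormal basis of `g` adapted to the family `V` of subspaces: for each `i` the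
vectors `e i α` form a `B`-orthonormal basis of `V i`. -/
structure IsAdaptedBasis (V : Fin 8 → Submodule ℝ g) {d : Fin 8 → ℕ}
    (e : (i : Fin 8) → Fin (d i) → g) : Prop where
  span_eq : ∀ i, Submodule.span ℝ (Set.range (e i)) = V i
  orthonormal : ∀ i α β, B (e i α) (e i β) = if α = β then 1 else 0

/-- The quantity `(ijk) = ∑ B([e_α^i, e_β^j], e_γ^k)²`. -/
noncomputable def quantity {d : Fin 8 → ℕ} (e : (i : Fin 8) → Fin (d i) → g) (i j k : Fin 8) : ℝ :=
  ∑ α, ∑ β, ∑ γ, B ⁅e i α, e j β⁆ (e k γ) ^ 2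

end

end E7I

/-! ### The root system of type E₇ as an explicit list -/

namespace E7I

open RootPairing

/-! Every bracket sum reduces to a few traces, and integrality determines these.

Normalisation. Each `A a` is spanned by a quaternion triple x, y, z, and so are the four copies of
su(2) in so(4) ⊕ so(4) ⊂ so(8) ≅ `D`. These are seven commuting triples, and 7 is the rank, so the
x's span a maximal abelian subspace. Its complexification is a Cartan subalgebra in which each ix is
a coroot. For a root α of E₇, the squares of the pairings of all roots with the coroot of α sum to
72, and these pairings lie in {-1, 0, 1} except at ±α. Hence B(x, x) = 72 and (ad x)³ = -ad x on
every m_i (`finrank_and_B_and_cubed_of_commuting_triples`, `IsDecomposition.exists_isModel`).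

Reduction to traces. If [k_i, k_j] ⊂ k_j, then (ijj) is the trace over k_i of the invariant form ∑
B([x, e], [y, e]), with e running over an orthonormal basis of k_j. On su(2) and so(8) its value at
one generator determines this trace (`IsInvariantForm.sum_triple`, `IsInvariantForm.sum_rotation`).
This gives (111), (222), (333) and (444) at once. On m_i, irreducibility and the cubic relation
leave two cases: `A a` acts by zero, or (ad x_a)² = -1. With n_i = dim m_i the trace is thus ε_ai
n_i, where ε_ai ∈ {0, 1}. For w = `l 0 1 + l 2 3` in `D`, -(ad w)² is a projection of m_i, with
trace a natural number τ_i.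

Counting. From dim g = 133 comes ∑ n_i = 96. Expanding B(x_a, x_a) = B(w, w) = 72 as traces gives
∑_i ε_ai n_i = 64 and ∑ τ_i = 48. Summing the bracket sums over two indices gives n_i = 2(∑_a
(a,i,i) + (4,i,i) + (567)), where in the brackets i stands for the index of m_i (`dim_m_eq`). Adding
the three identities yields (567) = 64/9, and then 36 n_i = 28 τ_i + 512 + 3 ∑_a ε_ai n_i. In
integers this forces n_i = 32, with exactly two of the ideals `A a` active on each m_i
(`dimensions_eq_of_spin_pattern`). The row sums make each `A a` trivial on exactly one m_i, which
gives the numbering and the remaining values. -/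

/-- The rows of the Cartan matrix of type `E₇`, that is, the simple roots in the coordinates given
by the pairings with the simple coroots. -/
def simpleWeights : List (List ℤ) :=
  List.ofFn fun i => List.ofFn fun j => CartanMatrix.E₇ i j

/-- The simple reflections, in the coordinates given by the pairings with the simple coroots. -/
def reflectWeight (k : ℕ) (v : List ℤ) : List ℤ :=
  List.zipWith (fun a c => a - v.getD k 0 * c) v (simpleWeights.getD k [])

/-- The roots that are obtained from the roots in `l` by a simple reflection that increases the
height by one. -/
def raiseWeights (l : List (List ℤ)) : List (List ℤ) :=
  (l.flatMap fun v => ((List.range 7).filter fun k => v.getD k 0 = -1).map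
    fun k => reflectWeight k v).dedup

/-- The roots of height at least `n + 1` and at most `18`. -/
def rootWeightsFrom : ℕ → List (List ℤ) → List (List ℤ)
  | 0, _ => []
  | n + 1, l => l ++ rootWeightsFrom n (raiseWeights l)

/-- The roots of the root system of type `E₇`, in the coordinates given by the pairings with the
simple coroots. -/
def rootWeights : List (List ℤ) :=
  -- The highest root of E₇ has height 17, so seventeen layers exhaust the positive roots.
  let l := rootWeightsFrom 17 simpleWeights
  l ++ l.map fun v => v.map fun a => -a

theorem rootWeights_length : rootWeights.length = 126 := by decide +kernel

theorem rootWeights_nodup : rootWeights.Nodup := by decide +kernel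

/-- With closure under negation and membership of the simple roots, this is what the induction over
roots in `weightCoords_mem` needs. -/
theorem reflectWeight_mem : ∀ v ∈ rootWeights, ∀ k < 7, reflectWeight k v ∈ rootWeights := by
  decide +kernel

theorem neg_mem_rootWeights : ∀ v ∈ rootWeights, (v.map fun a => -a) ∈ rootWeights := by
  decide +kernel

theorem simpleWeights_subset : ∀ v ∈ simpleWeights, v ∈ rootWeights := by
  decide +kernel

/-- E₇ is simply laced. Testing simple coroots suffices, since Weyl invariance carries the result to
all roots. -/
theorem rootWeights_getD : ∀ v ∈ rootWeights, ∀ k < 7,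
    v.getD k 0 ∈ [-1, 0, 1] ∨ v = simpleWeights.getD k [] ∨
      (v.map fun a => -a) = simpleWeights.getD k [] := by
  decide +kernel

/-- The root and its negative contribute 4 each; the 64 roots with pairing ±1 contribute 1 each. -/
theorem sum_rootWeights : ∀ k < 7, (rootWeights.map fun v => v.getD k 0 ^ 2).sum = 72 := by
  decide +kernel

end E7I

/-! ### Identification of an abstract root system with the list -/

namespace E7I

open RootPairing

section

set_option linter.unusedSectionVars false

variable {ι M N : Type*} [Fintype ι] [AddCommGroup M] [Module ℂ M] [AddCommGroup N] [Module ℂ N]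
  {P : RootPairing ι ℂ M N} [P.IsRootSystem] [P.IsCrystallographic] [P.IsReduced]

/-- The coordinates of a root given by its pairings with the simple coroots. -/
noncomputable def weightCoords (b : P.Base) (e : b.support ≃ Fin 7) (i : ι) : List ℤ :=
  List.ofFn fun k => P.pairingIn ℤ i (e.symm k)

variable {b : P.Base} {e : b.support ≃ Fin 7}

theorem weightCoords_getD (i : ι) (k : Fin 7) :
    (weightCoords b e i).getD k 0 = P.pairingIn ℤ i (e.symm k) := by
  rw [List.getD_eq_getElem _ _ (by simp [weightCoords])]
  simp only [weightCoords, List.getElem_ofFn]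

theorem weightCoords_injective : Function.Injective (weightCoords b e) := by
  intro i j hij
  refine b.injective_pairingIn (funext fun k => ?_)
  have := congrArg (fun l : List ℤ => l.getD (e k) 0) hij
  simpa only [weightCoords_getD, e.symm_apply_apply] using this

theorem pairingIn_reflectionPerm_left (i j l : ι) :
    P.pairingIn ℤ (P.reflectionPerm j i) l =
      P.pairingIn ℤ i l - P.pairingIn ℤ i j * P.pairingIn ℤ j l := by
  apply FaithfulSMul.algebraMap_injective ℤ ℂ
  rw [map_sub, map_mul]
  simp only [algebraMap_pairingIn]
  rw [← P.root_coroot'_eq_pairing, P.root_reflectionPerm, P.reflection_apply]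
  simp [P.root_coroot'_eq_pairing]

theorem weightCoords_reflectionPerm_self (i : ι) :
    weightCoords b e (P.reflectionPerm i i) = (weightCoords b e i).map fun a => -a := by
  apply List.ext_getElem
  · simp [weightCoords]
  · intro n h1 h2
    simp only [weightCoords, List.getElem_ofFn, List.getElem_map, pairingIn_reflectionPerm_left,
      P.pairingIn_same]
    ring

variable (he : ∀ i j, b.cartanMatrix i j = CartanMatrix.E₇ (e i) (e j))
include he

theorem weightCoords_simple (k : Fin 7) :
    weightCoords b e (e.symm k) = simpleWeights.getD k [] := by
  have : ∀ l, P.pairingIn ℤ (e.symm k) (e.symm l) = CartanMatrix.E₇ k l := fun l => by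
    have := he (e.symm k) (e.symm l)
    rwa [e.apply_symm_apply, e.apply_symm_apply] at this
  rw [List.getD_eq_getElem _ _ (by simp [simpleWeights])]
  simp only [weightCoords, simpleWeights, this, List.getElem_ofFn]

theorem weightCoords_reflectionPerm_simple (i : ι) (k : Fin 7) :
    weightCoords b e (P.reflectionPerm (e.symm k) i) = reflectWeight k (weightCoords b e i) := by
  rw [reflectWeight, weightCoords_getD, ← weightCoords_simple he]
  apply List.ext_getElem
  · simp [weightCoords]
  · intro n h1 h2
    simp [weightCoords, pairingIn_reflectionPerm_left]

theorem weightCoords_mem (i : ι) : weightCoords b e i ∈ rootWeights := by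
  induction i using b.induction_reflect with
  | h₀ i hi =>
    rw [weightCoords_reflectionPerm_self]
    exact neg_mem_rootWeights _ hi
  | h₁ i hi =>
    have := weightCoords_simple he (e ⟨i, hi⟩)
    rw [e.symm_apply_apply] at this
    rw [this]
    apply simpleWeights_subset
    generalize e ⟨i, hi⟩ = k
    revert k
    decide
  | h₂ i j hi hj =>
    have := weightCoords_reflectionPerm_simple he i (e ⟨j, hj⟩)
    rw [e.symm_apply_apply] at this
    rw [this]
    exact reflectWeight_mem _ hi _ (e ⟨j, hj⟩).2

theorem exists_weightCoords_of_mem_raiseWeights {l : List (List ℤ)}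
    (hl : ∀ v ∈ l, ∃ i, weightCoords b e i = v) :
    ∀ v ∈ raiseWeights l, ∃ i, weightCoords b e i = v := by
  intro v hv
  simp only [raiseWeights, List.mem_dedup, List.mem_flatMap, List.mem_map, List.mem_filter,
    List.mem_range] at hv
  obtain ⟨u, hu, k, ⟨hk, -⟩, rfl⟩ := hv
  obtain ⟨i, rfl⟩ := hl u hu
  exact ⟨_, weightCoords_reflectionPerm_simple he i ⟨k, hk⟩⟩

theorem exists_weightCoords_of_mem_rootWeightsFrom (n : ℕ) {l : List (List ℤ)}
    (hl : ∀ v ∈ l, ∃ i, weightCoords b e i = v) :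
    ∀ v ∈ rootWeightsFrom n l, ∃ i, weightCoords b e i = v := by
  induction n generalizing l with
  | zero => simp [rootWeightsFrom]
  | succ n ih =>
    intro v hv
    rw [rootWeightsFrom, List.mem_append] at hv
    exact hv.elim (hl v) (ih (exists_weightCoords_of_mem_raiseWeights he hl) v)

theorem exists_weightCoords {v : List ℤ} (hv : v ∈ rootWeights) :
    ∃ i, weightCoords b e i = v := by
  have key : ∀ v ∈ rootWeightsFrom 17 simpleWeights, ∃ i, weightCoords b e i = v := by
    refine exists_weightCoords_of_mem_rootWeightsFrom he 17 fun v hv => ?_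
    obtain ⟨k, rfl⟩ : ∃ k : Fin 7, simpleWeights.getD k [] = v := by
      revert v
      decide
    exact ⟨_, weightCoords_simple he k⟩
  rw [rootWeights, List.mem_append, List.mem_map] at hv
  rcases hv with hv | ⟨u, hu, rfl⟩
  · exact key v hv
  · obtain ⟨i, rfl⟩ := key u hu
    exact ⟨_, weightCoords_reflectionPerm_self i⟩

theorem image_weightCoords [DecidableEq (List ℤ)] :
    (Finset.univ : Finset ι).image (weightCoords b e) = rootWeights.toFinset := by
  ext v
  simp only [Finset.mem_image, Finset.mem_univ, true_and, List.mem_toFinset]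
  exact ⟨fun ⟨i, hi⟩ => hi ▸ weightCoords_mem he i, exists_weightCoords he⟩

theorem card_root_of_cartanMatrix_eq : Fintype.card ι = 126 := by
  classical
  rw [← Finset.card_univ, ← Finset.card_image_of_injective _ (weightCoords_injective (b := b) (e := e)),
    image_weightCoords he, List.toFinset_card_of_nodup rootWeights_nodup, rootWeights_length]

/-- Both properties hold at simple roots by inspection of the list. They pass from `j` to its
reflections because a reflection permutes the roots and preserves pairings. -/
theorem pairingIn_of_cartanMatrix_eq (j : ι) :
    (∀ i, P.pairingIn ℤ i j ∈ [-1, 0, 1] ∨ i = j ∨ P.root i = -P.root j) ∧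
      ∑ i, P.pairingIn ℤ i j ^ 2 = 72 := by
  induction j using b.induction_reflect with
  | h₀ j hj =>
    simp only [P.pairingIn_reflectionPerm_self_right, neg_sq]
    refine ⟨fun i => ?_, hj.2⟩
    rw [P.root_reflectionPerm, P.reflection_apply_self, neg_neg]
    rcases hj.1 i with h | rfl | h
    · left
      simp only [List.mem_cons, List.not_mem_nil] at h ⊢
      lia
    · exact Or.inr (Or.inr rfl)
    · refine Or.inr (Or.inl (P.root.injective ?_))
      rw [h, P.root_reflectionPerm, P.reflection_apply_self]
  | h₁ j hj =>
    obtain ⟨k, hk⟩ : ∃ k, (e.symm k : ι) = j := ⟨e ⟨j, hj⟩, by simp⟩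
    subst hk
    constructor
    · intro i
      have := rootWeights_getD _ (weightCoords_mem he i) k k.2
      rw [weightCoords_getD, ← weightCoords_simple he, ← weightCoords_reflectionPerm_self] at this
      refine this.imp_right (Or.imp (fun h => weightCoords_injective h) fun h => ?_)
      rw [← weightCoords_injective h, P.root_reflectionPerm, P.reflection_apply_self, neg_neg]
    · have := sum_rootWeights k k.2
      rw [← List.sum_toFinset _ rootWeights_nodup, ← image_weightCoords he,
        Finset.sum_image (fun _ _ _ _ h => weightCoords_injective h)] at this
      simpa only [weightCoords_getD] using this
  | h₂ j l hj hl =>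
    simp only [P.pairingIn_reflectionPerm]
    refine ⟨fun i => ?_, ?_⟩
    · refine (hj.1 (P.reflectionPerm l i)).imp_right (Or.imp (fun h => ?_) fun h => ?_)
      · rw [← h, P.reflectionPerm_self]
      · rw [P.root_reflectionPerm] at h ⊢
        rw [← map_neg, ← h, P.reflection_same]
    · rw [← hj.2]
      exact (P.reflectionPerm l).sum_comp fun i => P.pairingIn ℤ i j ^ 2
end

end E7I

/-! ### Dimension, Killing form and spectrum of a coroot in type E₇ -/

namespace E7I

open LieAlgebra LieAlgebra.IsKilling LieModule Module

section

variable {L : Type*} [LieRing L] [LieAlgebra ℂ L] [FiniteDimensional ℂ L] [IsKilling ℂ L]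
  {H : LieSubalgebra ℂ L} [H.IsCartanSubalgebra]

theorem finrank_eq_finrank_cartan_add_card_root [Nontrivial L] :
    finrank ℂ L = finrank ℂ H + Fintype.card H.root := by
  classical
  have hds := DirectSum.isInternal_submodule_of_iSupIndep_of_iSup_eq_top
    (LieSubmodule.iSupIndep_toSubmodule.mpr <| iSupIndep_genWeightSpace' ℂ H L)
    (LieSubmodule.iSup_toSubmodule_eq_top.mpr <| iSup_genWeightSpace_eq_top' ℂ H L)
  have h1 : finrank ℂ L = ∑ χ : Weight ℂ H L, finrank ℂ (genWeightSpace L χ) := by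
    rw [← (LinearEquiv.ofBijective (DirectSum.coeLinearMap _) hds).finrank_eq, finrank_directSum]
    rfl
  have h2 : (Finset.univ.filter fun χ : Weight ℂ H L => ¬ χ.IsNonZero) = {0} := by
    ext χ
    simp [Weight.IsNonZero, Weight.isZero_iff_eq_zero]
  rw [h1, ← Finset.sum_filter_add_sum_filter_not _ fun χ : Weight ℂ H L => χ.IsNonZero, h2,
    Finset.sum_singleton, add_comm]
  congr 1
  · rw [FunLike.coe_zero]
    exact congrArg (fun N : LieSubmodule ℂ H L => finrank ℂ N) (rootSpace_zero_eq ℂ L H)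
  · rw [Finset.sum_congr rfl fun χ hχ => finrank_rootSpace_eq_one χ (by simpa using hχ)]
    rw [Finset.sum_const, smul_eq_mul, mul_one, Fintype.card_coe]

theorem finrank_cartan {b : (rootSystem H).Base} (e : b.support ≃ Fin 7) : finrank ℂ H = 7 := by
  rw [← Subspace.dual_finrank_eq, Module.finrank_eq_card_basis b.toWeightBasis,
    Fintype.card_congr e, Fintype.card_fin]

variable {b : (rootSystem H).Base} {e : b.support ≃ Fin 7}
  (hb : ∀ i j, b.cartanMatrix i j = CartanMatrix.E₇ (e i) (e j))
include hb

theorem finrank_eq_133 [Nontrivial L] : finrank ℂ L = 133 := by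
  rw [finrank_eq_finrank_cartan_add_card_root (H := H), finrank_cartan e,
    card_root_of_cartanMatrix_eq hb]

/-- On a Cartan subalgebra the Killing form is the sum of the squares of the roots. -/
theorem killingForm_coroot (α : H.root) :
    killingForm ℂ L (coroot α.1) (coroot α.1) = 72 := by
  have h1 := LinearMap.congr_fun₂ (corootForm_rootSystem_eq_killing (K := ℂ) H)
    (coroot α.1) (coroot α.1)
  have h2 := congrArg (Int.cast : ℤ → ℂ) (pairingIn_of_cartanMatrix_eq hb α).2
  have h3 : ∀ β : H.root, (((rootSystem H).pairingIn ℤ β α : ℤ) : ℂ) = β.1 (coroot α.1) :=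
    fun β => (rootSystem H).algebraMap_pairingIn ℤ β α
  push_cast [h3] at h2
  rw [← h2]
  refine h1.symm.trans ?_
  refine ((rootSystem H).corootForm_apply_apply _ _).trans (Finset.sum_congr rfl fun β _ => ?_)
  rw [sq]
  rfl

/-- The coroot of α acts on the β-root space by the pairing of β with it, a zero of t³ - t unless β
= ±α. The two exceptional root spaces are the lines through `x` and `y`. -/
theorem lie_coroot_cubed_mem {α : H.root} {x y : L} (hx : x ∈ rootSpace H α.1) (hx0 : x ≠ 0)
    (hy : y ∈ rootSpace H (-α.1)) (hy0 : y ≠ 0) (v : L) :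
    ⁅(coroot α.1 : L), ⁅(coroot α.1 : L), ⁅(coroot α.1 : L), v⁆⁆⁆ - ⁅(coroot α.1 : L), v⁆ ∈
      Submodule.span ℂ {x, y} := by
  have hv : v ∈ ⨆ χ : Weight ℂ H L, genWeightSpace L χ := by
    simp [iSup_genWeightSpace_eq_top' ℂ H L]
  have hspan : ∀ β : Weight ℂ H L, β.IsNonZero → ∀ z ∈ rootSpace H β, z ≠ 0 →
      ∀ u ∈ rootSpace H β, u ∈ Submodule.span ℂ {z} := by
    intro β hβ z hz hz0 u hu
    obtain ⟨c, hc⟩ := (finrank_eq_one_iff_of_nonzero' (⟨z, hz⟩ : rootSpace H β)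
      (by simpa using hz0)).mp (finrank_rootSpace_eq_one β hβ) ⟨u, hu⟩
    exact Submodule.mem_span_singleton.mpr ⟨c, congrArg Subtype.val hc⟩
  induction hv using LieSubmodule.iSup_induction' with
  | zero => simp
  | add u w _ _ hu hw =>
    simp only [lie_add]
    convert! add_mem hu hw using 1
    abel
  | mem χ u hu =>
    have h1 : ⁅(coroot α.1 : L), u⁆ = χ (coroot α.1) • u :=
      lie_eq_smul_of_mem_rootSpace hu (coroot α.1)
    simp only [h1, lie_smul, smul_smul, ← sub_smul]
    by_cases hχ : χ.IsNonZero
    · let β : H.root := ⟨χ, by simpa using hχ⟩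
      have h3 : (((rootSystem H).pairingIn ℤ β α : ℤ) : ℂ) = χ (coroot α.1) :=
        (rootSystem H).algebraMap_pairingIn ℤ β α
      rcases (pairingIn_of_cartanMatrix_eq hb α).1 β with h | h | h
      · rw [← h3]
        have : (rootSystem H).pairingIn ℤ β α = -1 ∨ (rootSystem H).pairingIn ℤ β α = 0 ∨
          (rootSystem H).pairingIn ℤ β α = 1 := by simpa using h
        rcases this with h | h | h <;> simp [h]
      · refine Submodule.smul_mem _ _ (Submodule.span_mono (by simp) (hspan χ hχ x ?_ hx0 u hu))
        rw [← h] at hx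
        exact hx
      · have h4 : χ = -α.1 := by
          ext t
          exact LinearMap.congr_fun h t
        refine Submodule.smul_mem _ _ (Submodule.span_mono (by simp) (hspan χ hχ y ?_ hy0 u hu))
        exact h4 ▸ hy
    · rw [not_not] at hχ
      simp [hχ.eq]

end

end E7I

/-! ### The form `B` and the complexification of a compact Lie algebra -/

namespace E7I

open LieAlgebra Module

section

variable {g : Type*} [LieRing g] [LieAlgebra ℝ g]

theorem B_comm (x y : g) : B x y = B y x := by
  rw [B, B, LieModule.traceForm_comm]

@[simp] theorem B_add_left (x y z : g) : B (x + y) z = B x z + B y z := by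
  simp [B, add_comm]

@[simp] theorem B_add_right (x y z : g) : B x (y + z) = B x y + B x z := by
  simp [B, add_comm]

@[simp] theorem B_smul_left (c : ℝ) (x y : g) : B (c • x) y = c * B x y := by
  simp [B]

@[simp] theorem B_smul_right (c : ℝ) (x y : g) : B x (c • y) = c * B x y := by
  simp [B]

@[simp] theorem B_neg_left (x y : g) : B (-x) y = -B x y := by
  simp [B]

@[simp] theorem B_neg_right (x y : g) : B x (-y) = -B x y := by
  simp [B]

@[simp] theorem B_sub_left (x y z : g) : B (x - y) z = B x z - B y z := by
  rw [sub_eq_add_neg, B_add_left, B_neg_left, sub_eq_add_neg]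

@[simp] theorem B_sub_right (x y z : g) : B x (y - z) = B x y - B x z := by
  rw [sub_eq_add_neg, B_add_right, B_neg_right, sub_eq_add_neg]

@[simp] theorem B_zero_left (x : g) : B 0 x = 0 := by
  simp [B]

@[simp] theorem B_zero_right (x : g) : B x 0 = 0 := by
  simp [B]

theorem B_sum_left {ι : Type*} (s : Finset ι) (f : ι → g) (y : g) :
    B (∑ i ∈ s, f i) y = ∑ i ∈ s, B (f i) y := by
  simp [B, LinearMap.sum_apply]

theorem B_sum_right {ι : Type*} (s : Finset ι) (f : ι → g) (y : g) :
    B y (∑ i ∈ s, f i) = ∑ i ∈ s, B y (f i) := by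
  simp [B]

theorem B_lie_left (x y z : g) : B ⁅x, y⁆ z = B x ⁅y, z⁆ := by
  rw [B, B, LieModule.traceForm_apply_lie_apply]

theorem B_lie_skew (x y z : g) : B ⁅x, y⁆ z = -B y ⁅x, z⁆ := by
  rw [← lie_skew, B_neg_left, B_lie_left]

section complexification

variable (g) in
/-- The real part of an element of the complexification. -/
noncomputable def rePart : ℂ ⊗[ℝ] g →ₗ[ℝ] g :=
  (TensorProduct.lid ℝ g).toLinearMap ∘ₗ LinearMap.rTensor g Complex.reLm

variable (g) in
/-- The imaginary part of an element of the complexification. -/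
noncomputable def imPart : ℂ ⊗[ℝ] g →ₗ[ℝ] g :=
  (TensorProduct.lid ℝ g).toLinearMap ∘ₗ LinearMap.rTensor g Complex.imLm

@[simp] theorem rePart_tmul (c : ℂ) (x : g) : rePart g (c ⊗ₜ x) = c.re • x := by
  simp [rePart]

@[simp] theorem imPart_tmul (c : ℂ) (x : g) : imPart g (c ⊗ₜ x) = c.im • x := by
  simp [imPart]

theorem eq_rePart_add_imPart (z : ℂ ⊗[ℝ] g) :
    z = (1 : ℂ) ⊗ₜ[ℝ] rePart g z + Complex.I ⊗ₜ[ℝ] imPart g z := by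
  induction z using TensorProduct.induction_on with
  | zero => simp
  | add x y hx hy =>
    rw [map_add, map_add, TensorProduct.tmul_add, TensorProduct.tmul_add]
    nth_rewrite 1 [hx, hy]
    abel
  | tmul c x =>
    rw [rePart_tmul, imPart_tmul, TensorProduct.tmul_smul, TensorProduct.tmul_smul,
      TensorProduct.smul_tmul', TensorProduct.smul_tmul', ← TensorProduct.add_tmul]
    congr 1
    apply Complex.ext <;> simp

theorem rePart_smul (c : ℂ) (z : ℂ ⊗[ℝ] g) :
    rePart g (c • z) = c.re • rePart g z - c.im • imPart g z := by
  induction z using TensorProduct.induction_on with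
  | zero => simp
  | add x y hx hy => simp only [smul_add, map_add, hx, hy]; abel
  | tmul a x => simp [TensorProduct.smul_tmul', sub_smul, smul_smul]

theorem imPart_smul (c : ℂ) (z : ℂ ⊗[ℝ] g) :
    imPart g (c • z) = c.re • imPart g z + c.im • rePart g z := by
  induction z using TensorProduct.induction_on with
  | zero => simp
  | add x y hx hy => simp only [smul_add, map_add, hx, hy]; abel
  | tmul a x => simp [TensorProduct.smul_tmul', add_smul, smul_smul]

theorem rePart_baseChange (f : g →ₗ[ℝ] g) (z : ℂ ⊗[ℝ] g) :
    rePart g (f.baseChange ℂ z) = f (rePart g z) := by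
  induction z using TensorProduct.induction_on with
  | zero => simp
  | add x y hx hy => simp only [map_add, hx, hy]
  | tmul a x => simp

theorem imPart_baseChange (f : g →ₗ[ℝ] g) (z : ℂ ⊗[ℝ] g) :
    imPart g (f.baseChange ℂ z) = f (imPart g z) := by
  induction z using TensorProduct.induction_on with
  | zero => simp
  | add x y hx hy => simp only [map_add, hx, hy]
  | tmul a x => simp

theorem lie_one_tmul (x : g) (z : ℂ ⊗[ℝ] g) :
    ⁅(1 : ℂ) ⊗ₜ[ℝ] x, z⁆ = (ad ℝ g x).baseChange ℂ z :=
  LinearMap.congr_fun (LieModule.toEnd_baseChange ℝ ℂ g g x) z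

theorem rePart_lie (x : g) (z : ℂ ⊗[ℝ] g) :
    rePart g ⁅(1 : ℂ) ⊗ₜ[ℝ] x, z⁆ = ⁅x, rePart g z⁆ := by
  rw [lie_one_tmul, rePart_baseChange, ad_apply]

theorem imPart_lie (x : g) (z : ℂ ⊗[ℝ] g) :
    imPart g ⁅(1 : ℂ) ⊗ₜ[ℝ] x, z⁆ = ⁅x, imPart g z⁆ := by
  rw [lie_one_tmul, imPart_baseChange, ad_apply]

theorem mem_baseChange_iff (W : Submodule ℝ g) (z : ℂ ⊗[ℝ] g) :
    z ∈ W.baseChange ℂ ↔ rePart g z ∈ W ∧ imPart g z ∈ W := by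
  constructor
  · intro hz
    rw [Submodule.baseChange_eq_span] at hz
    induction hz using Submodule.span_induction with
    | zero => simp
    | add x y _ _ hx hy =>
      rw [map_add, map_add]
      exact ⟨add_mem hx.1 hy.1, add_mem hx.2 hy.2⟩
    | smul c x _ hx =>
      rw [rePart_smul, imPart_smul]
      exact ⟨sub_mem (W.smul_mem _ hx.1) (W.smul_mem _ hx.2),
        add_mem (W.smul_mem _ hx.2) (W.smul_mem _ hx.1)⟩
    | mem x hx =>
      obtain ⟨w, hw, rfl⟩ := hx
      simpa using hw
  · rintro ⟨h1, h2⟩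
    rw [eq_rePart_add_imPart z]
    exact add_mem (Submodule.tmul_mem_baseChange_of_mem _ h1)
      (Submodule.tmul_mem_baseChange_of_mem _ h2)

/-- The complexification of an abelian subspace, as a subalgebra. -/
noncomputable def complexify (W : Submodule ℝ g) (hW : ∀ x ∈ W, ∀ y ∈ W, ⁅x, y⁆ = 0) :
    LieSubalgebra ℂ (ℂ ⊗[ℝ] g) where
  __ := W.baseChange ℂ
  lie_mem' := by
    intro x y hx hy
    have hx' := (mem_baseChange_iff W x).mp hx
    have hy' := (mem_baseChange_iff W y).mp hy
    have : ⁅x, y⁆ = 0 := by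
      rw [eq_rePart_add_imPart x, eq_rePart_add_imPart y]
      simp [LieAlgebra.ExtendScalars.bracket_tmul, hW _ hx'.1 _ hy'.1, hW _ hx'.1 _ hy'.2,
        hW _ hx'.2 _ hy'.1, hW _ hx'.2 _ hy'.2]
    rw [this]
    exact (W.baseChange ℂ).zero_mem

theorem mem_complexify {W : Submodule ℝ g} {hW : ∀ x ∈ W, ∀ y ∈ W, ⁅x, y⁆ = 0}
    {z : ℂ ⊗[ℝ] g} : z ∈ complexify W hW ↔ rePart g z ∈ W ∧ imPart g z ∈ W :=
  mem_baseChange_iff W z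

theorem lie_lie_eq_zero_of_mem_complexify {W : Submodule ℝ g} {hW : ∀ x ∈ W, ∀ y ∈ W, ⁅x, y⁆ = 0}
    {x y : ℂ ⊗[ℝ] g} (hx : x ∈ complexify W hW) (hy : y ∈ complexify W hW) : ⁅x, y⁆ = 0 := by
  rw [mem_complexify] at hx hy
  rw [eq_rePart_add_imPart x, eq_rePart_add_imPart y]
  simp [LieAlgebra.ExtendScalars.bracket_tmul, hW _ hx.1 _ hy.1, hW _ hx.1 _ hy.2,
    hW _ hx.2 _ hy.1, hW _ hx.2 _ hy.2]

/-- The operator ad x is skew for a definite form, so it has the same kernel as its square. -/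
theorem lie_eq_zero_of_lie_lie_eq_zero (hB : ∀ x : g, x ≠ 0 → 0 < B x x) {x y : g}
    (h : ⁅x, ⁅x, y⁆⁆ = 0) : ⁅x, y⁆ = 0 := by
  by_contra h0
  have := hB _ h0
  rw [B_lie_skew, h, B_zero_right, neg_zero] at this
  exact lt_irrefl _ this

/-- If z normalises the complexification, then [x, z] has real and imaginary parts in `W` for x in
`W`, so ad x squared kills the parts of z. By skewness ad x already kills them, and `hmax` puts them
in `W`. -/
theorem complexify_isCartanSubalgebra (hB : ∀ x : g, x ≠ 0 → 0 < B x x) {W : Submodule ℝ g}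
    (hW : ∀ x ∈ W, ∀ y ∈ W, ⁅x, y⁆ = 0)
    (hmax : ∀ z, (∀ x ∈ W, ⁅x, z⁆ = 0) → z ∈ W) : (complexify W hW).IsCartanSubalgebra where
  nilpotent := by
    have : IsLieAbelian (complexify W hW) :=
      ⟨fun x y => Subtype.ext (lie_lie_eq_zero_of_mem_complexify x.2 y.2)⟩
    infer_instance
  self_normalizing := by
    refine le_antisymm (fun z hz => ?_) (LieSubalgebra.le_normalizer _)
    rw [LieSubalgebra.mem_normalizer_iff] at hz
    have key : ∀ x ∈ W, ⁅x, rePart g z⁆ = 0 ∧ ⁅x, imPart g z⁆ = 0 := by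
      intro x hx
      have hx' : (1 : ℂ) ⊗ₜ[ℝ] x ∈ complexify W hW := by
        rw [mem_complexify]
        simpa using hx
      have := mem_complexify.mp (hz _ hx')
      rw [← lie_skew, map_neg, map_neg, neg_mem_iff, neg_mem_iff, rePart_lie, imPart_lie] at this
      exact ⟨lie_eq_zero_of_lie_lie_eq_zero hB (hW _ hx _ this.1),
        lie_eq_zero_of_lie_lie_eq_zero hB (hW _ hx _ this.2)⟩
    exact mem_complexify.mpr ⟨hmax _ fun x hx => (key x hx).1, hmax _ fun x hx => (key x hx).2⟩

theorem exists_maximal_abelian [FiniteDimensional ℝ g] {W : Submodule ℝ g}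
    (hW : ∀ x ∈ W, ∀ y ∈ W, ⁅x, y⁆ = 0) :
    ∃ V : Submodule ℝ g, W ≤ V ∧ (∀ x ∈ V, ∀ y ∈ V, ⁅x, y⁆ = 0) ∧
      ∀ z, (∀ x ∈ V, ⁅x, z⁆ = 0) → z ∈ V := by
  obtain ⟨V, hV⟩ := exists_maximal_of_wellFoundedGT
    (fun V : Submodule ℝ g => W ≤ V ∧ ∀ x ∈ V, ∀ y ∈ V, ⁅x, y⁆ = 0) ⟨W, le_rfl, hW⟩
  refine ⟨V, hV.prop.1, hV.prop.2, fun z hz => ?_⟩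
  have hle : V ⊔ Submodule.span ℝ {z} ≤ V := by
    refine hV.le_of_ge ⟨hV.prop.1.trans le_sup_left, ?_⟩ le_sup_left
    intro x hx y hy
    obtain ⟨u, hu, a, ha, rfl⟩ := Submodule.mem_sup.mp hx
    obtain ⟨v, hv, b, hb, rfl⟩ := Submodule.mem_sup.mp hy
    obtain ⟨s, rfl⟩ := Submodule.mem_span_singleton.mp ha
    obtain ⟨t, rfl⟩ := Submodule.mem_span_singleton.mp hb
    simp [hV.prop.2 u hu v hv, hz u hu, ← lie_skew z v, hz v hv]
  exact hle (Submodule.mem_sup_right (Submodule.mem_span_singleton_self z))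

theorem finrank_complexify [FiniteDimensional ℝ g] (W : Submodule ℝ g)
    (hW : ∀ x ∈ W, ∀ y ∈ W, ⁅x, y⁆ = 0) : finrank ℂ (complexify W hW) = finrank ℝ W := by
  rw [← Module.finrank_baseChange (R := ℂ) (S := ℝ) (M' := W)]
  exact (Submodule.toBaseChange.toLinearEquiv ℂ W).finrank_eq.symm

end complexification

end

end E7I

/-! ### Quaternion triples and coroots -/

namespace E7I

open LieAlgebra LieAlgebra.IsKilling Module

/-- Three elements of a Lie algebra that satisfy the bracket relations of the quaternion units. -/
structure IsQuaternionTriple (R : Type*) {L : Type*} [CommRing R] [LieRing L] [LieAlgebra R L]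
    (x y z : L) : Prop where
  lie_x_y : ⁅x, y⁆ = (2 : R) • z
  lie_y_z : ⁅y, z⁆ = (2 : R) • x
  lie_z_x : ⁅z, x⁆ = (2 : R) • y

section

variable {L : Type*} [LieRing L] [LieAlgebra ℂ L]

theorem IsQuaternionTriple.lie_x_z {R : Type*} {L : Type*} [CommRing R] [LieRing L]
    [LieAlgebra R L] {x y z : L} (h : IsQuaternionTriple R x y z) : ⁅x, z⁆ = -((2 : R) • y) := by
  rw [← lie_skew, h.lie_z_x]

/-- The factor -1/4 compensates [y + iz, y - iz] = -4ix. -/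
theorem IsQuaternionTriple.isSl2Triple {x y z : L} (h : IsQuaternionTriple ℂ x y z) (hx : x ≠ 0) :
    IsSl2Triple (Complex.I • x) (y + Complex.I • z) (-(4⁻¹ : ℂ) • (y - Complex.I • z)) where
  h_ne_zero := by simpa using hx
  lie_e_f := by
    have : ⁅z, y⁆ = -((2 : ℂ) • x) := by rw [← lie_skew, h.lie_y_z]
    simp only [lie_smul, add_lie, smul_lie, lie_sub, lie_self, h.lie_y_z, this]
    module
  lie_h_e_nsmul := by
    simp only [smul_lie, lie_add, lie_smul, h.lie_x_y, h.lie_x_z]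
    linear_combination (norm := module) (-(2 : ℂ)) • Complex.I_mul_I • y
  lie_h_f_nsmul := by
    simp only [smul_lie, lie_sub, lie_smul, h.lie_x_y, h.lie_x_z]
    linear_combination (norm := module) (-(2⁻¹ : ℂ)) • Complex.I_mul_I • y

variable [FiniteDimensional ℂ L] [IsKilling ℂ L] {H : LieSubalgebra ℂ L} [H.IsCartanSubalgebra]

/-- Simultaneous eigenvectors of `H` are weight vectors. The weight of e is nonzero because h acts
on e by 2, and the sl₂ relations then identify h with the coroot. -/
theorem exists_root_of_isSl2Triple {h e f : L} (ht : IsSl2Triple h e f) (hh : h ∈ H)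
    (hef : ∀ t ∈ H, ∃ c : ℂ, ⁅t, e⁆ = c • e ∧ ⁅t, f⁆ = -c • f) :
    ∃ α : H.root, e ∈ rootSpace H α.1 ∧ f ∈ rootSpace H (-α.1) ∧ h = coroot α.1 := by
  choose χ hχe hχf using fun t : H => hef t t.2
  have he : e ∈ rootSpace H χ :=
    LieModule.weightSpace_le_genWeightSpace L χ ((LieModule.mem_weightSpace χ e).mpr hχe)
  have hf : f ∈ rootSpace H (-χ) :=
    LieModule.weightSpace_le_genWeightSpace L (-χ) ((LieModule.mem_weightSpace (-χ) f).mpr hχf)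
  let α : LieModule.Weight ℂ H L := ⟨χ, fun h0 => ht.e_ne_zero (by
    have h1 : e ∈ LieModule.genWeightSpace L χ := he
    rw [h0] at h1
    simpa using h1)⟩
  have hα : α.IsNonZero := by
    intro h0
    have h1 : χ ⟨h, hh⟩ = 0 := congrFun h0 ⟨h, hh⟩
    have h2 := hχe ⟨h, hh⟩
    rw [h1, zero_smul] at h2
    have h3 := ht.lie_h_e_smul ℂ
    rw [h2] at h3
    exact ht.e_ne_zero (by simpa using h3.symm)
  exact ⟨⟨α, by simpa using hα⟩, he, hf, ht.h_eq_coroot hα he hf⟩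

variable {b : (rootSystem H).Base} {e : b.support ≃ Fin 7}
  (hb : ∀ i j, b.cartanMatrix i j = CartanMatrix.E₇ (e i) (e j))
include hb

/-- As the `x q` span `H` and commute with `y p`, `z p` for q ≠ p, the vectors y ± iz of the triple
at `p` are root vectors and i `x p` is a coroot. Passing from ix to x changes 72 into -72 and t³ - t
into t³ + t. -/
theorem killingForm_and_cubed_of_isQuaternionTriple {x y z : Fin 7 → L}
    (hspan : H.toSubmodule = Submodule.span ℂ (Set.range x))
    (hx0 : ∀ p, x p ≠ 0) (htriple : ∀ p, IsQuaternionTriple ℂ (x p) (y p) (z p))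
    (hy : ∀ p q, p ≠ q → ⁅x p, y q⁆ = 0) (hz : ∀ p q, p ≠ q → ⁅x p, z q⁆ = 0) (p : Fin 7) :
    killingForm ℂ L (x p) (x p) = -72 ∧
      ∀ v, ∃ r s : ℂ, ⁅x p, ⁅x p, ⁅x p, v⁆⁆⁆ + ⁅x p, v⁆ = r • y p + s • z p := by
  have ht := (htriple p).isSl2Triple (hx0 p)
  have hH : ∀ t, t ∈ H ↔ t ∈ Submodule.span ℂ (Set.range x) := fun t => by
    rw [← hspan]
    rfl
  obtain ⟨α, he, hf, hα⟩ := exists_root_of_isSl2Triple (H := H) ht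
    ((hH _).mpr (Submodule.smul_mem _ _ (Submodule.subset_span ⟨p, rfl⟩))) (by
      intro t ht'
      rw [hH] at ht'
      induction ht' using Submodule.span_induction with
      | zero => exact ⟨0, by simp, by simp⟩
      | add u v _ _ hu hv =>
        obtain ⟨c, hc, hc'⟩ := hu
        obtain ⟨d, hd, hd'⟩ := hv
        refine ⟨c + d, ?_, ?_⟩
        · rw [add_lie, hc, hd, add_smul]
        · rw [add_lie, hc', hd', neg_add, add_smul]
      | smul a u _ hu =>
        obtain ⟨c, hc, hc'⟩ := hu
        refine ⟨a * c, ?_, ?_⟩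
        · rw [smul_lie, hc, smul_smul]
        · rw [smul_lie, hc', smul_smul, mul_neg]
      | mem u hu =>
        obtain ⟨q, rfl⟩ := hu
        rcases eq_or_ne q p with rfl | hqp
        · refine ⟨-2 * Complex.I, ?_, ?_⟩
          · simp only [lie_add, lie_smul, (htriple q).lie_x_y, (htriple q).lie_x_z]
            linear_combination (norm := module) (2 : ℂ) • Complex.I_mul_I • z q
          · simp only [lie_sub, lie_smul, (htriple q).lie_x_y, (htriple q).lie_x_z]
            linear_combination (norm := module) (-(2⁻¹) : ℂ) • Complex.I_mul_I • z q
        · exact ⟨0, by simp [hy q p hqp, hz q p hqp], by simp [hy q p hqp, hz q p hqp]⟩)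
  constructor
  · have h1 := killingForm_coroot hb α
    rw [← hα] at h1
    simp only [map_smul, LinearMap.smul_apply, smul_eq_mul] at h1
    linear_combination -h1 + killingForm ℂ L (x p) (x p) * Complex.I_mul_I
  · intro v
    have h1 := lie_coroot_cubed_mem hb he ht.e_ne_zero hf ht.f_ne_zero v
    rw [← hα, Submodule.mem_span_pair] at h1
    obtain ⟨r, s, hrs⟩ := h1
    -- `r` and `s` are coefficients with respect to y + iz and -(y - iz)/4. They are rewritten in y
    -- and z and multiplied by i, because (i ad x)³ - i ad x = -i((ad x)³ + ad x).
    refine ⟨Complex.I * (r - s / 4), - (r + s / 4), ?_⟩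
    simp only [smul_lie, lie_smul] at hrs
    linear_combination (norm := module) (-Complex.I) • hrs +
      (1 - Complex.I * Complex.I) • Complex.I_mul_I • ⁅x p, ⁅x p, ⁅x p, v⁆⁆⁆ +
      Complex.I_mul_I • ⁅x p, v⁆ +
      (r + s / 4) • Complex.I_mul_I • z p

end

section

variable {g : Type*} [LieRing g] [LieAlgebra ℝ g]

theorem IsQuaternionTriple.complexify {x y z : g} (h : IsQuaternionTriple ℝ x y z) :
    IsQuaternionTriple ℂ (1 ⊗ₜ x : ℂ ⊗[ℝ] g) (1 ⊗ₜ y) (1 ⊗ₜ z) := by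
  have h2 : ∀ w : g, (1 : ℂ) ⊗ₜ[ℝ] ((2 : ℝ) • w) = (2 : ℂ) • (1 ⊗ₜ w : ℂ ⊗[ℝ] g) := fun w => by
    rw [TensorProduct.tmul_smul, TensorProduct.smul_tmul', TensorProduct.smul_tmul']
    simp
  constructor
  · rw [lie_one_tmul, LinearMap.baseChange_tmul, ad_apply, h.lie_x_y, h2]
  · rw [lie_one_tmul, LinearMap.baseChange_tmul, ad_apply, h.lie_y_z, h2]
  · rw [lie_one_tmul, LinearMap.baseChange_tmul, ad_apply, h.lie_z_x, h2]

theorem one_tmul_lie_one_tmul (x y : g) :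
    ⁅(1 ⊗ₜ x : ℂ ⊗[ℝ] g), (1 ⊗ₜ y : ℂ ⊗[ℝ] g)⁆ = 1 ⊗ₜ ⁅x, y⁆ := by
  rw [lie_one_tmul, LinearMap.baseChange_tmul, ad_apply]

theorem IsQuaternionTriple.B_eq_zero {x y z w : g} (h : IsQuaternionTriple ℝ x y z)
    (hw : ⁅w, y⁆ = 0) : B w x = 0 := by
  have h1 : B w ((2 : ℝ) • x) = 0 := by rw [← h.lie_y_z, ← B_lie_left, hw, B_zero_left]
  simpa using h1

variable [FiniteDimensional ℝ g] (hB : ∀ x : g, x ≠ 0 → 0 < B x x)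
  (hE : IsTypeE7 (ℂ ⊗[ℝ] g)) {x y z : Fin 7 → g}
  (htriple : ∀ p, IsQuaternionTriple ℝ (x p) (y p) (z p)) (hx0 : ∀ p, x p ≠ 0)
  (hx : ∀ p q, p ≠ q → ⁅x p, x q⁆ = 0) (hy : ∀ p q, p ≠ q → ⁅x p, y q⁆ = 0)
  (hz : ∀ p q, p ≠ q → ⁅x p, z q⁆ = 0)
include hB hE htriple hx0 hx hy hz

/-- The `x p` are pairwise orthogonal, hence independent, and there are as many as the rank, so they
span a maximal abelian subspace. Over ℂ, (ad x)³v + [x, v] is a combination of y and z. If v is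
orthogonal to y and z, so is this vector by invariance, and definiteness makes it vanish. -/
theorem finrank_and_B_and_cubed_of_commuting_triples :
    finrank ℝ g = 133 ∧ ∀ p, B (x p) (x p) = 72 ∧ ∀ v, B v (y p) = 0 → B v (z p) = 0 →
      ⁅x p, ⁅x p, ⁅x p, v⁆⁆⁆ = -⁅x p, v⁆ := by
  have hli : LinearIndependent ℝ x := by
    rw [linearIndependent_iff']
    intro s c hc p hp
    have h1 := congrArg (fun v => B v (x p)) hc
    simp only [B_sum_left, B_smul_left, B_zero_left] at h1
    rw [Finset.sum_eq_single p (fun q _ hqp => by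
      rw [(htriple p).B_eq_zero (hy q p hqp), mul_zero]) (fun h => absurd hp h)] at h1
    exact (mul_eq_zero.mp h1).resolve_right (hB _ (hx0 p)).ne'
  have hT : ∀ u ∈ Submodule.span ℝ (Set.range x), ∀ v ∈ Submodule.span ℝ (Set.range x),
      ⁅u, v⁆ = 0 := by
    intro u hu v hv
    induction hu, hv using Submodule.span_induction₂ with
    | mem_mem a b ha hb =>
      obtain ⟨p, rfl⟩ := ha
      obtain ⟨q, rfl⟩ := hb
      rcases eq_or_ne p q with rfl | hpq
      · exact lie_self _
      · exact hx p q hpq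
    | zero_left => simp
    | zero_right => simp
    | add_left _ _ _ _ _ _ h1 h2 => rw [add_lie, h1, h2, add_zero]
    | add_right _ _ _ _ _ _ h1 h2 => rw [lie_add, h1, h2, add_zero]
    | smul_left _ _ _ _ _ h => rw [smul_lie, h, smul_zero]
    | smul_right _ _ _ _ _ h => rw [lie_smul, h, smul_zero]
  obtain ⟨V, hTV, hV, hmax⟩ := exists_maximal_abelian hT
  obtain ⟨hK, hall⟩ := hE
  have hcartan := complexify_isCartanSubalgebra hB hV hmax
  obtain ⟨b, e, hb⟩ := hall (complexify V hV)
  have h7 : finrank ℝ V = 7 := by rw [← finrank_complexify V hV, finrank_cartan e]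
  have hVT : Submodule.span ℝ (Set.range x) = V := by
    refine Submodule.eq_of_le_of_finrank_eq hTV ?_
    rw [h7, finrank_span_eq_card hli, Fintype.card_fin]
  have hspan : (complexify V hV).toSubmodule =
      Submodule.span ℂ (Set.range fun p => (1 ⊗ₜ x p : ℂ ⊗[ℝ] g)) := by
    refine Eq.trans (show _ = V.baseChange ℂ from rfl) ?_
    rw [← hVT, Submodule.baseChange_span]
    congr 1
    rw [← Set.range_comp]
    rfl
  have hne : ∀ p, (1 ⊗ₜ x p : ℂ ⊗[ℝ] g) ≠ 0 := by
    intro p h0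
    apply hx0 p
    simpa using congrArg (rePart g) h0
  have hL : Nontrivial (ℂ ⊗[ℝ] g) := ⟨_, _, hne 0⟩
  refine ⟨?_, fun p => ?_⟩
  · rw [← Module.finrank_baseChange (R := ℂ) (S := ℝ) (M' := g)]
    exact finrank_eq_133 hb
  obtain ⟨h1, h2⟩ := killingForm_and_cubed_of_isQuaternionTriple hb hspan hne
    (fun p => (htriple p).complexify)
    (fun p q hpq => by rw [one_tmul_lie_one_tmul, hy p q hpq, TensorProduct.tmul_zero])
    (fun p q hpq => by rw [one_tmul_lie_one_tmul, hz p q hpq, TensorProduct.tmul_zero]) p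
  constructor
  · have h3 := LieModule.traceForm_baseChange (R := ℝ) (A := ℂ) (L := g) (M := g)
    have h4 := LinearMap.congr_fun₂ h3 ((1 : ℂ) ⊗ₜ[ℝ] x p) ((1 : ℂ) ⊗ₜ[ℝ] x p)
    rw [LinearMap.BilinForm.baseChange_tmul] at h4
    have h5 : killingForm ℝ g (x p) (x p) = -72 := by
      simpa using congrArg Complex.re (h4.symm.trans h1)
    rw [B, h5, neg_neg]
  · intro v hvy hvz
    obtain ⟨r, s, hrs⟩ := h2 (1 ⊗ₜ v)
    have h3 := congrArg (rePart g) hrs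
    simp only [one_tmul_lie_one_tmul, map_add, rePart_smul, rePart_tmul, imPart_tmul,
      Complex.one_re, Complex.one_im, one_smul, zero_smul, smul_zero, sub_zero] at h3
    rw [← add_eq_zero_iff_eq_neg]
    by_contra h0
    have h4 := hB _ h0
    have hxy := (htriple p).lie_x_y
    have hxz := (htriple p).lie_x_z
    have h5 : B (⁅x p, ⁅x p, ⁅x p, v⁆⁆⁆ + ⁅x p, v⁆) (y p) = 0 := by
      simp [B_lie_skew, hxy, hxz, hvz]
    have h6 : B (⁅x p, ⁅x p, ⁅x p, v⁆⁆⁆ + ⁅x p, v⁆) (z p) = 0 := by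
      simp [B_lie_skew, hxy, hxz, hvy]
    nth_rewrite 2 [h3] at h4
    rw [B_add_right, B_smul_right, B_smul_right, h5, h6] at h4
    simp at h4

end

end E7I

/-! ### Matrix models of su(2) and so(n) -/

namespace E7I

/-- Elements of a Lie algebra that satisfy the bracket relations of the elementary rotations
`E i j - E j i` of the orthogonal Lie algebra. -/
structure IsRotationFrame {ι L : Type*} [LieRing L] (l : ι → ι → L) : Prop where
  swap : ∀ i j, l j i = -l i j
  lie_of_ne : ∀ i j k, i ≠ j → j ≠ k → i ≠ k → ⁅l i j, l j k⁆ = l i k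
  lie_disjoint : ∀ i j k m, i ≠ k → i ≠ m → j ≠ k → j ≠ m → ⁅l i j, l k m⁆ = 0
  ne_zero : ∀ i j, i ≠ j → l i j ≠ 0

namespace IsRotationFrame

variable {ι L : Type*} [LieRing L] {l : ι → ι → L} (h : IsRotationFrame l)
include h

theorem lie_left_left {i j k : ι} (hij : i ≠ j) (hjk : j ≠ k) (hik : i ≠ k) :
    ⁅l i j, l i k⁆ = -l j k := by
  rw [h.swap j i, neg_lie, h.lie_of_ne j i k hij.symm hik hjk]

theorem lie_right_right {i j k : ι} (hij : i ≠ j) (hjk : j ≠ k) (hik : i ≠ k) :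
    ⁅l i j, l k j⁆ = -l i k := by
  rw [h.swap j k, lie_neg, h.lie_of_ne i j k hij hjk hik]

theorem lie_left_right {i j k : ι} (hij : i ≠ j) (hjk : j ≠ k) (hik : i ≠ k) :
    ⁅l i j, l k i⁆ = l j k := by
  rw [h.swap i k, lie_neg, h.lie_left_left hij hjk hik, neg_neg]

/-- These are the self-dual rotations in so(4) = su(2) ⊕ su(2) on the coordinates a, b, c, d.
Exchanging c and d gives the anti-self-dual ones. -/
theorem isQuaternionTriple [LieAlgebra ℝ L] {a b c d : ι} (hab : a ≠ b) (hac : a ≠ c) (had : a ≠ d)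
    (hbc : b ≠ c) (hbd : b ≠ d) (hcd : c ≠ d) :
    IsQuaternionTriple ℝ (l a b + l c d) (l a c + l d b) (-(l a d + l b c)) where
  lie_x_y := by
    rw [add_lie, lie_add, lie_add, h.lie_left_left hab hbc hac, h.lie_right_right hab hbd had,
      h.lie_left_right hcd had.symm hac.symm, h.lie_of_ne c d b hcd hbd.symm hbc.symm,
      h.swap a d, h.swap b c]
    module
  lie_y_z := by
    rw [lie_neg, add_lie, lie_add, lie_add, h.lie_left_left hac hcd had,
      h.lie_right_right hac hbc.symm hab, h.lie_left_right hbd.symm hab.symm had.symm,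
      h.lie_of_ne d b c hbd.symm hbc hcd.symm, h.swap c d, h.swap a b]
    module
  lie_z_x := by
    rw [neg_lie, add_lie, lie_add, lie_add, h.lie_left_left had hbd.symm hab,
      h.lie_right_right had hcd.symm hac, h.lie_left_right hbc hac.symm hab.symm,
      h.lie_of_ne b c d hbc hcd hbd, h.swap a c, h.swap d b]
    module

theorem lie_self_dual_anti_self_dual {a b c d : ι} (hab : a ≠ b) (hac : a ≠ c) (had : a ≠ d)
    (hbc : b ≠ c) (hbd : b ≠ d) (hcd : c ≠ d) :
    ⁅l a b + l c d, l a b + l d c⁆ = 0 ∧ ⁅l a b + l c d, l a d + l c b⁆ = 0 ∧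
      ⁅l a b + l c d, -(l a c + l b d)⁆ = 0 := by
  refine ⟨?_, ?_, ?_⟩
  · rw [add_lie, lie_add, lie_add, lie_self, h.lie_disjoint a b d c had hac hbd hbc,
      h.lie_disjoint c d a b hac.symm hbc.symm had.symm hbd.symm, h.swap c d, lie_neg, lie_self]
    simp
  · rw [add_lie, lie_add, lie_add, h.lie_left_left hab hbd had, h.lie_right_right hab hbc hac,
      h.lie_right_right hcd had.symm hac.symm, h.lie_left_left hcd hbd.symm hbc.symm,
      h.swap b d, h.swap a c]
    abel
  · rw [lie_neg, add_lie, lie_add, lie_add, h.lie_left_left hab hbc hac, h.lie_of_ne a b d hab hbd had,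
      h.lie_left_right hcd had.symm hac.symm, h.lie_right_right hcd hbd.symm hbc.symm,
      h.swap a d, h.swap b c]
    abel

/-- Bracketing with `l b e` kills `l c d` and turns `l a b` into `l a e`. -/
theorem add_ne_zero {a b c d e : ι} (hab : a ≠ b) (hbe : b ≠ e) (hae : a ≠ e)
    (hbc : b ≠ c) (hbd : b ≠ d) (hec : e ≠ c) (hed : e ≠ d) : l a b + l c d ≠ 0 := by
  intro h0
  have h1 : ⁅l a b + l c d, l b e⁆ = 0 := by rw [h0, zero_lie]
  rw [add_lie, h.lie_of_ne a b e hab hbe hae,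
    h.lie_disjoint c d b e hbc.symm hec.symm hbd.symm hed.symm, add_zero] at h1
  exact h.ne_zero a e hae h1

end IsRotationFrame

section

attribute [local instance] LieRing.ofAssociativeRing

theorem exists_isQuaternionTriple_su :
    ∃ x y z : su 2, IsQuaternionTriple ℝ x y z ∧ x ≠ 0 ∧ Submodule.span ℝ {x, y, z} = ⊤ := by
  refine ⟨⟨!![Complex.I, 0; 0, -Complex.I], ?_, ?_⟩, ⟨!![0, 1; -1, 0], ?_, ?_⟩,
    ⟨!![0, Complex.I; Complex.I, 0], ?_, ?_⟩, ⟨?_, ?_, ?_⟩, ?_, ?_⟩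
  · ext i j; fin_cases i <;> fin_cases j <;> simp
  · simp [Matrix.trace_fin_two]
  · ext i j; fin_cases i <;> fin_cases j <;> simp
  · simp [Matrix.trace_fin_two]
  · ext i j; fin_cases i <;> fin_cases j <;> simp
  · simp [Matrix.trace_fin_two]
  · apply Subtype.ext
    ext i j; fin_cases i <;> fin_cases j <;> simp [Ring.lie_def, two_mul]
  · apply Subtype.ext
    ext i j; fin_cases i <;> fin_cases j <;> simp [Ring.lie_def, two_mul]; ring
  · apply Subtype.ext
    ext i j; fin_cases i <;> fin_cases j <;> simp [Ring.lie_def] <;> ring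
  · intro h0
    have := congrFun (congrFun (congrArg Subtype.val h0) 0) 0
    simp at this
  · rw [eq_top_iff]
    rintro ⟨M, hM, htr⟩ -
    rw [Submodule.mem_span_triple]
    refine ⟨(M 0 0).im, (M 0 1).re, (M 0 1).im, ?_⟩
    have h1 := fun i j => congrFun (congrFun hM i) j
    simp only [Matrix.conjTranspose_apply, Matrix.neg_apply, Complex.ext_iff] at h1
    have h00 := h1 0 0
    have h01 := h1 0 1
    rw [Matrix.trace_fin_two, Complex.ext_iff] at htr
    simp at h00 h01 htr
    apply Subtype.ext
    ext i j
    fin_cases i <;> fin_cases j <;> apply Complex.ext <;> simp <;> linarith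

/-- The elementary rotations of the orthogonal Lie algebra. -/
def rotation {n : Type*} [Fintype n] [DecidableEq n] (i j : n) :
    LieAlgebra.Orthogonal.so n ℝ :=
  ⟨Matrix.single i j 1 - Matrix.single j i 1, by
    rw [LieAlgebra.Orthogonal.mem_so]
    simp⟩

theorem isRotationFrame_rotation {n : Type*} [Fintype n] [DecidableEq n] :
    IsRotationFrame (rotation (n := n)) where
  swap i j := by
    apply Subtype.ext
    simp [rotation]
  lie_of_ne i j k hij hjk hik := by
    apply Subtype.ext
    simp [rotation, Ring.lie_def, mul_sub, sub_mul, hij, hjk, hik, hij.symm, hjk.symm, hik.symm,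
      Matrix.single_mul_single_of_ne]
  lie_disjoint i j k m hik him hjk hjm := by
    apply Subtype.ext
    simp [rotation, Ring.lie_def, mul_sub, sub_mul, hik, him, hjk, hjm, hik.symm, hjk.symm,
      him.symm, hjm.symm, Matrix.single_mul_single_of_ne]
  ne_zero i j hij h0 := by
    have := congrFun (congrFun (congrArg Subtype.val h0) i) j
    simp [rotation, hij] at this

theorem span_rotation {n : Type*} [Fintype n] [DecidableEq n] :
    Submodule.span ℝ (Set.range fun p : n × n => rotation p.1 p.2) = ⊤ := by
  rw [eq_top_iff]
  rintro ⟨M, hM⟩ -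
  rw [LieAlgebra.Orthogonal.mem_so] at hM
  have : (⟨M, (LieAlgebra.Orthogonal.mem_so n ℝ M).mpr hM⟩ : LieAlgebra.Orthogonal.so n ℝ) =
      ∑ p : n × n, (M p.1 p.2 / 2) • rotation p.1 p.2 := by
    apply Subtype.ext
    ext i j
    have h1 := congrFun (congrFun hM i) j
    simp only [Matrix.transpose_apply, Matrix.neg_apply] at h1
    have h2 : (∑ p : n × n, (M p.1 p.2 / 2) • rotation p.1 p.2 : LieAlgebra.Orthogonal.so n ℝ).1 i j
        = M i j / 2 - M j i / 2 := by
      rw [← LieSubalgebra.coe_incl, map_sum, Matrix.sum_apply, Fintype.sum_prod_type]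
      simp [rotation, mul_sub, Matrix.single_apply, Finset.sum_sub_distrib, ite_and]
    rw [h2, h1]
    ring
  rw [this]
  exact Submodule.sum_mem _ fun p _ =>
    Submodule.smul_mem _ _ (Submodule.subset_span ⟨p, rfl⟩)

end

section

attribute [local instance] LieRing.ofAssociativeRing

variable {g : Type*} [LieRing g] [LieAlgebra ℝ g]

theorem exists_isQuaternionTriple_of_equiv {A : LieSubalgebra ℝ g} (e : A ≃ₗ⁅ℝ⁆ su 2) :
    ∃ x y z : g, IsQuaternionTriple ℝ x y z ∧ x ≠ 0 ∧
      Submodule.span ℝ {x, y, z} = A.toSubmodule := by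
  obtain ⟨x, y, z, h, hx, hspan⟩ := exists_isQuaternionTriple_su
  let f : su 2 →ₗ⁅ℝ⁆ g := A.incl.comp e.symm.toLieHom
  have hf : Function.Injective f := Subtype.val_injective.comp e.symm.injective
  refine ⟨f x, f y, f z, ⟨?_, ?_, ?_⟩, ?_, ?_⟩
  · rw [← LieHom.map_lie, h.lie_x_y, map_smul]
  · rw [← LieHom.map_lie, h.lie_y_z, map_smul]
  · rw [← LieHom.map_lie, h.lie_z_x, map_smul]
  · rwa [Ne, map_eq_zero_iff f hf]
  · have h1 := congrArg (Submodule.map (f : su 2 →ₗ[ℝ] g)) hspan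
    rw [Submodule.map_span, Submodule.map_top] at h1
    simp only [Set.image_insert_eq, Set.image_singleton] at h1
    refine h1.trans ?_
    ext v
    constructor
    · rintro ⟨u, rfl⟩
      exact (e.symm u).2
    · intro hv
      exact ⟨e ⟨v, hv⟩, by simp [f]⟩

theorem exists_isRotationFrame_of_equiv {n : Type*} [Fintype n] [DecidableEq n]
    {D : LieSubalgebra ℝ g} (e : D ≃ₗ⁅ℝ⁆ LieAlgebra.Orthogonal.so n ℝ) :
    ∃ l : n → n → g, IsRotationFrame l ∧
      Submodule.span ℝ (Set.range fun p : n × n => l p.1 p.2) = D.toSubmodule := by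
  have h := isRotationFrame_rotation (n := n)
  let f : LieAlgebra.Orthogonal.so n ℝ →ₗ⁅ℝ⁆ g := D.incl.comp e.symm.toLieHom
  have hf : Function.Injective f := Subtype.val_injective.comp e.symm.injective
  refine ⟨fun i j => f (rotation i j), ⟨?_, ?_, ?_, ?_⟩, ?_⟩
  · intro i j
    rw [h.swap i j, map_neg]
  · intro i j k hij hjk hik
    rw [← LieHom.map_lie, h.lie_of_ne i j k hij hjk hik]
  · intro i j k m hik him hjk hjm
    rw [← LieHom.map_lie, h.lie_disjoint i j k m hik him hjk hjm, map_zero]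
  · intro i j hij
    rw [Ne, map_eq_zero_iff f hf]
    exact h.ne_zero i j hij
  · have h1 := congrArg (Submodule.map (f : LieAlgebra.Orthogonal.so n ℝ →ₗ[ℝ] g))
      (span_rotation (n := n))
    rw [Submodule.map_span, Submodule.map_top, ← Set.range_comp] at h1
    refine h1.trans ?_
    ext v
    constructor
    · rintro ⟨u, rfl⟩
      exact (e.symm u).2
    · intro hv
      exact ⟨e ⟨v, hv⟩, by simp [f]⟩

end

end E7I

/-! ### Orthonormal bases and invariant forms -/

namespace E7I

variable {g : Type*} [LieRing g] [LieAlgebra ℝ g]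

/-- `e` is a `B`-orthonormal basis of the subspace `V`. -/
structure IsOrthonormalBasis {ι : Type*} [DecidableEq ι] (V : Submodule ℝ g) (e : ι → g) :
    Prop where
  span_eq : Submodule.span ℝ (Set.range e) = V
  orthonormal : ∀ α β, B (e α) (e β) = if α = β then 1 else 0

namespace IsOrthonormalBasis

variable {ι κ : Type*} [Fintype ι] [DecidableEq ι] [Fintype κ] [DecidableEq κ]
  {V : Submodule ℝ g} {e : ι → g} (he : IsOrthonormalBasis V e)
include he

omit [Fintype ι] in
theorem mem (α : ι) : e α ∈ V := he.span_eq ▸ Submodule.subset_span ⟨α, rfl⟩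

theorem sum_B_smul {v : g} (hv : v ∈ V) : ∑ α, B v (e α) • e α = v := by
  rw [← he.span_eq] at hv
  induction hv using Submodule.span_induction with
  | zero => simp
  | add x y _ _ hx hy => simp only [B_add_left, add_smul, Finset.sum_add_distrib, hx, hy]
  | smul c x _ hx => simp only [B_smul_left, mul_smul, ← Finset.smul_sum, hx]
  | mem x hx =>
    obtain ⟨β, rfl⟩ := hx
    simp [he.orthonormal]

theorem sum_B_mul_B {u v : g} (hu : u ∈ V) : ∑ α, B u (e α) * B v (e α) = B u v := by
  conv_rhs => rw [← he.sum_B_smul hu]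
  rw [B_sum_left]
  exact Finset.sum_congr rfl fun α _ => by rw [B_smul_left, B_comm v]

theorem sum_B_sq {u : g} (hu : u ∈ V) : ∑ α, B u (e α) ^ 2 = B u u := by
  rw [← he.sum_B_mul_B hu]
  simp only [sq]

/-- The sum is the trace of `φ` relative to `B` on `V`. Its independence of the basis lets explicit
generators replace an arbitrary adapted basis. -/
theorem sum_bilin_eq {f : κ → g} (hf : IsOrthonormalBasis V f) (φ : LinearMap.BilinForm ℝ g) :
    ∑ α, φ (e α) (e α) = ∑ β, φ (f β) (f β) := by
  have h1 : ∀ α, φ (e α) (e α) = ∑ β, ∑ γ, B (f β) (e α) * B (f γ) (e α) * φ (f β) (f γ) := by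
    intro α
    conv_lhs => rw [← hf.sum_B_smul (he.mem α)]
    simp only [map_sum, LinearMap.sum_apply, map_smul, LinearMap.smul_apply, smul_eq_mul,
      Finset.mul_sum]
    rw [Finset.sum_comm]
    refine Finset.sum_congr rfl fun β _ => Finset.sum_congr rfl fun γ _ => ?_
    rw [B_comm (e α), B_comm (e α)]
    ring
  simp only [h1]
  rw [Finset.sum_comm]
  refine Finset.sum_congr rfl fun β _ => ?_
  rw [Finset.sum_comm]
  have h2 : ∀ γ, ∑ α, B (f β) (e α) * B (f γ) (e α) * φ (f β) (f γ) =
      if β = γ then φ (f β) (f β) else 0 := by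
    intro γ
    rw [← Finset.sum_mul, he.sum_B_mul_B (hf.mem β), hf.orthonormal]
    split_ifs with h
    · rw [h, one_mul]
    · rw [zero_mul]
  simp [h2]

theorem linearIndependent : LinearIndependent ℝ e := by
  rw [Fintype.linearIndependent_iff]
  intro c hc α
  have := congrArg (fun v => B v (e α)) hc
  simpa [B_sum_left, he.orthonormal] using this

theorem card_eq_finrank : Fintype.card ι = Module.finrank ℝ V := by
  rw [← he.span_eq, finrank_span_eq_card he.linearIndependent]

theorem trace_eq [FiniteDimensional ℝ g] (f : V →ₗ[ℝ] V) :
    LinearMap.trace ℝ V f = ∑ α, B (f ⟨e α, he.mem α⟩ : g) (e α) := by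
  have hli : LinearIndependent ℝ fun α => (⟨e α, he.mem α⟩ : V) :=
    LinearIndependent.of_comp V.subtype he.linearIndependent
  have hspan : ⊤ ≤ Submodule.span ℝ (Set.range fun α => (⟨e α, he.mem α⟩ : V)) := by
    rintro ⟨v, hv⟩ -
    have : (⟨v, hv⟩ : V) = ∑ α, B v (e α) • (⟨e α, he.mem α⟩ : V) := by
      apply Subtype.ext
      simpa using (he.sum_B_smul hv).symm
    rw [this]
    exact Submodule.sum_mem _ fun α _ => Submodule.smul_mem _ _ (Submodule.subset_span ⟨α, rfl⟩)
  obtain ⟨b, hbe⟩ : ∃ b : Module.Basis ι ℝ V, ∀ α, b α = ⟨e α, he.mem α⟩ :=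
    ⟨Module.Basis.mk hli hspan, Module.Basis.mk_apply hli hspan⟩
  have hb : ∀ v : V, ∀ α, b.repr v α = B (v : g) (e α) := by
    intro v α
    have h1 := congrArg (fun w : V => B (w : g) (e α)) (b.sum_repr v)
    simp only [hbe, AddSubmonoidClass.coe_finsetSum, SetLike.val_smul,
      B_sum_left, B_smul_left, he.orthonormal] at h1
    simpa using h1
  rw [LinearMap.trace_eq_matrix_trace ℝ b, Matrix.trace]
  refine Finset.sum_congr rfl fun α _ => ?_
  rw [Matrix.diag_apply, LinearMap.toMatrix_apply, hb, hbe]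

end IsOrthonormalBasis

/-- The bilinear form `∑ B([x, e α], [y, e α])`. -/
noncomputable def adForm {ι : Type*} [Fintype ι] (e : ι → g) : LinearMap.BilinForm ℝ g :=
  LinearMap.mk₂ ℝ (fun x y => ∑ α, B ⁅x, e α⁆ ⁅y, e α⁆)
    (fun x y z => by simp [Finset.sum_add_distrib])
    (fun c x y => by simp [Finset.mul_sum])
    (fun x y z => by simp [Finset.sum_add_distrib])
    (fun c x y => by simp [Finset.mul_sum])

theorem adForm_apply {ι : Type*} [Fintype ι] (e : ι → g) (x y : g) :
    adForm e x y = ∑ α, B ⁅x, e α⁆ ⁅y, e α⁆ := rfl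

theorem adForm_comm {ι : Type*} [Fintype ι] (e : ι → g) (x y : g) :
    adForm e x y = adForm e y x := by
  simp only [adForm_apply, B_comm]

/-- A symmetric bilinear form that is invariant under the subspace `W`. -/
structure IsInvariantForm (W : Submodule ℝ g) (φ : LinearMap.BilinForm ℝ g) : Prop where
  comm : ∀ x y, φ x y = φ y x
  lie : ∀ z ∈ W, ∀ x y, φ ⁅z, x⁆ y = -φ x ⁅z, y⁆

/-- An element of `W` acts on `V` by a skew matrix in the basis `e`. It therefore rotates the basis
infinitesimally, and the variation of the sum coming from the basis cancels. -/
theorem isInvariantForm_adForm {ι : Type*} [Fintype ι] [DecidableEq ι] {V W : Submodule ℝ g}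
    {e : ι → g} (he : IsOrthonormalBasis V e) (hW : ∀ z ∈ W, ∀ v ∈ V, ⁅z, v⁆ ∈ V) :
    IsInvariantForm W (adForm e) where
  comm := adForm_comm e
  lie z hz x y := by
    have h1 : ∑ α, B ⁅x, ⁅z, e α⁆⁆ ⁅y, e α⁆ + ∑ α, B ⁅x, e α⁆ ⁅y, ⁅z, e α⁆⁆ = 0 := by
      have h2 : ∀ α, B ⁅x, ⁅z, e α⁆⁆ ⁅y, e α⁆ =
          ∑ β, B ⁅z, e α⁆ (e β) * B ⁅x, e β⁆ ⁅y, e α⁆ := fun α => by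
        conv_lhs => rw [← he.sum_B_smul (hW z hz _ (he.mem α))]
        simp [lie_sum, B_sum_left]
      have h3 : ∀ α, B ⁅x, e α⁆ ⁅y, ⁅z, e α⁆⁆ =
          ∑ β, B ⁅z, e α⁆ (e β) * B ⁅x, e α⁆ ⁅y, e β⁆ := fun α => by
        conv_lhs => rw [← he.sum_B_smul (hW z hz _ (he.mem α))]
        simp [lie_sum, B_sum_right]
      simp only [h2, h3]
      rw [Finset.sum_comm, ← Finset.sum_add_distrib]
      refine Finset.sum_eq_zero fun α _ => ?_
      rw [← Finset.sum_add_distrib]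
      refine Finset.sum_eq_zero fun β _ => ?_
      rw [B_lie_skew z (e α) (e β), B_comm (e α)]
      ring
    simp only [adForm_apply, lie_lie, B_sub_left, B_sub_right, Finset.sum_sub_distrib]
    have h4 : ∀ α, B ⁅z, ⁅x, e α⁆⁆ ⁅y, e α⁆ = -B ⁅x, e α⁆ ⁅z, ⁅y, e α⁆⁆ := fun α => B_lie_skew _ _ _
    simp only [h4, Finset.sum_neg_distrib]
    linarith

/-- By invariance under `x` and `y`, the form on su(2) is a multiple of the standard one. -/
theorem IsInvariantForm.triple {W : Submodule ℝ g} {φ : LinearMap.BilinForm ℝ g}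
    (hφ : IsInvariantForm W φ) {x y z : g} (h : IsQuaternionTriple ℝ x y z) (hx : x ∈ W)
    (hy : y ∈ W) : φ x x = φ z z ∧ φ y y = φ z z ∧ φ x y = 0 ∧ φ x z = 0 ∧ φ y z = 0 := by
  have hzy : ⁅y, x⁆ = -((2 : ℝ) • z) := by rw [← lie_skew, h.lie_x_y]
  have h1 := hφ.lie y hy z x
  have h2 := hφ.lie x hx y z
  have h3 := hφ.lie x hx y y
  have h4 := hφ.lie x hx x y
  have h5 := hφ.lie y hy x y
  have hyz := h.lie_y_z
  have hxz := h.lie_x_z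
  have hxy := h.lie_x_y
  simp only [hyz, hxz, hxy, hzy, lie_self, map_neg, map_smul, LinearMap.neg_apply,
    LinearMap.smul_apply, smul_eq_mul, map_zero, LinearMap.zero_apply] at h1 h2 h3 h4 h5
  have h6 := hφ.comm z y
  have h7 := hφ.lie y hy z y
  have h8 := hφ.lie x hx z z
  simp only [hyz, hxz, lie_self, map_neg, map_smul, LinearMap.neg_apply,
    LinearMap.smul_apply, smul_eq_mul, map_zero] at h7 h8
  refine ⟨?_, ?_, ?_, ?_, ?_⟩ <;> linarith

theorem isInvariantForm_B : IsInvariantForm (⊤ : Submodule ℝ g) (-killingForm ℝ g) where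
  comm := B_comm
  lie z _ x y := B_lie_skew z x y

end E7I

/-! ### Invariant forms on so(8) and su(2) -/

namespace E7I

variable {g : Type*} [LieRing g] [LieAlgebra ℝ g]

namespace IsInvariantForm

variable {W : Submodule ℝ g} {φ : LinearMap.BilinForm ℝ g} (hφ : IsInvariantForm W φ)
  {l : Fin 8 → Fin 8 → g} (hl : IsRotationFrame l) (hW : ∀ i j, l i j ∈ W)
include hφ hl hW

/-- Since `l i j` is the bracket of `l i m` and `l m j`, invariance moves one factor across. A fresh
index m makes the new bracket vanish and gives orthogonality; taking z = `l i j` exchanges an index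
and gives equal norms. -/
theorem rotation_eq {i j m : Fin 8} (hij : i ≠ j) (him : i ≠ m) (hmj : m ≠ j) (z : g) :
    φ (l i j) z = φ (l i m) ⁅l m j, z⁆ := by
  rw [← hl.lie_of_ne i m j him hmj hij, ← lie_skew, map_neg, LinearMap.neg_apply,
    hφ.lie _ (hW m j), neg_neg]

theorem rotation_adjacent {i j k : Fin 8} (hij : i ≠ j) (hjk : j ≠ k) (hik : i ≠ k) :
    φ (l i j) (l i k) = 0 := by
  obtain ⟨m, hmi, hmj, hmk⟩ : ∃ m, m ≠ i ∧ m ≠ j ∧ m ≠ k := by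
    revert i j k; decide
  rw [hφ.rotation_eq hl hW hij hmi.symm hmj, hl.lie_disjoint m j i k hmi hmk hij.symm hjk, map_zero]

theorem rotation_disjoint {i j k m : Fin 8} (hij : i ≠ j) (hjk : j ≠ k) (hjm : j ≠ m) :
    φ (l i j) (l k m) = 0 := by
  obtain ⟨p, hpi, hpj, hpk, hpm⟩ : ∃ p, p ≠ i ∧ p ≠ j ∧ p ≠ k ∧ p ≠ m := by
    have : ∀ i j k m : Fin 8, ∃ p, p ≠ i ∧ p ≠ j ∧ p ≠ k ∧ p ≠ m := by decide +kernel
    exact this i j k m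
  rw [hφ.rotation_eq hl hW hij hpi.symm hpj, hl.lie_disjoint p j k m hpk hpm hjk hjm, map_zero]

omit hφ hW in
theorem rotation_self_swap (i j : Fin 8) : φ (l j i) (l j i) = φ (l i j) (l i j) := by
  rw [hl.swap i j, map_neg, map_neg, LinearMap.neg_apply, neg_neg]

theorem rotation_self_right {i j m : Fin 8} (hij : i ≠ j) (him : i ≠ m) (hmj : m ≠ j) :
    φ (l i j) (l i j) = φ (l i m) (l i m) := by
  rw [hφ.rotation_eq hl hW hij him hmj, hl.lie_right_right hmj hij.symm him.symm, ← hl.swap]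

theorem rotation_self {i j : Fin 8} (hij : i ≠ j) : φ (l i j) (l i j) = φ (l 0 1) (l 0 1) := by
  have h0 : ∀ {j : Fin 8}, 0 ≠ j → φ (l 0 j) (l 0 j) = φ (l 0 1) (l 0 1) := by
    intro j hj
    rcases eq_or_ne j 1 with rfl | h
    · rfl
    · exact hφ.rotation_self_right hl hW hj (by decide) h.symm
  rcases eq_or_ne i 0 with rfl | hi
  · exact h0 hij
  rcases eq_or_ne j 0 with rfl | hj
  · rw [rotation_self_swap hl]
    exact h0 hij.symm
  · rw [hφ.rotation_self_right hl hW hij hi hj.symm, rotation_self_swap hl]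
    exact h0 hi.symm

theorem rotation_add {i j k m : Fin 8} (hij : i ≠ j) (him : i ≠ m) (hjk : j ≠ k)
    (hjm : j ≠ m) (hkm : k ≠ m) :
    φ (l i j + l k m) (l i j + l k m) = 2 * φ (l 0 1) (l 0 1) := by
  simp only [map_add, LinearMap.add_apply]
  rw [hφ.rotation_self hl hW hij, hφ.rotation_self hl hW hkm, hφ.rotation_disjoint hl hW hij hjk hjm,
    hφ.rotation_disjoint hl hW hkm him.symm hjm.symm]
  ring

theorem rotation_of_ne {p q : {p : Fin 8 × Fin 8 // p.1 < p.2}} (hpq : p ≠ q) :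
    φ (l p.1.1 p.1.2) (l q.1.1 q.1.2) = 0 := by
  obtain ⟨⟨i, j⟩, hij⟩ := p
  obtain ⟨⟨k, m⟩, hkm⟩ := q
  simp only at hij hkm ⊢
  rcases eq_or_ne i k with rfl | hik
  · have hjm : j ≠ m := by
      rintro rfl
      exact hpq rfl
    exact hφ.rotation_adjacent hl hW hij.ne hjm hkm.ne
  rcases eq_or_ne j m with rfl | hjm
  · rw [hl.swap j i, hl.swap j k, map_neg, map_neg, LinearMap.neg_apply,
      hφ.rotation_adjacent hl hW hij.ne' hik hkm.ne']
    simp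
  rcases eq_or_ne i m with rfl | him
  · rw [hl.swap i k, map_neg, hφ.rotation_adjacent hl hW hij.ne (hkm.trans hij).ne' hkm.ne',
      neg_zero]
  rcases eq_or_ne j k with rfl | hjk
  · rw [hl.swap j i, map_neg, LinearMap.neg_apply,
      hφ.rotation_adjacent hl hW hij.ne' (hij.trans hkm).ne hkm.ne, neg_zero]
  exact hφ.rotation_disjoint hl hW hij.ne hjk hjm

end IsInvariantForm

theorem isOrthonormalBasis_rotation {D : Submodule ℝ g} {l : Fin 8 → Fin 8 → g}
    (hl : IsRotationFrame l)
    (hspan : Submodule.span ℝ (Set.range fun p : Fin 8 × Fin 8 => l p.1 p.2) = D)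
    (h36 : B (l 0 1) (l 0 1) = 36) :
    IsOrthonormalBasis D fun p : {p : Fin 8 × Fin 8 // p.1 < p.2} =>
      (6⁻¹ : ℝ) • l p.1.1 p.1.2 where
  span_eq := by
    rw [← hspan]
    apply le_antisymm
    · rw [Submodule.span_le]
      rintro _ ⟨p, rfl⟩
      exact Submodule.smul_mem _ _ (Submodule.subset_span ⟨p.1, rfl⟩)
    · rw [Submodule.span_le]
      rintro _ ⟨⟨i, j⟩, rfl⟩
      have key : ∀ i j, i < j → l i j ∈ Submodule.span ℝ
          (Set.range fun p : {p : Fin 8 × Fin 8 // p.1 < p.2} => (6⁻¹ : ℝ) • l p.1.1 p.1.2) := by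
        intro i j hij
        have : l i j = (6 : ℝ) • (6⁻¹ : ℝ) • l i j := by module
        rw [this]
        exact Submodule.smul_mem _ _ (Submodule.subset_span ⟨⟨(i, j), hij⟩, rfl⟩)
      rcases lt_trichotomy i j with h | rfl | h
      · exact key i j h
      · have : IsAddTorsionFree g := .of_isTorsionFree ℝ g
        have : l i i = 0 := self_eq_neg.mp (hl.swap i i)
        simp [this]
      · simp only [SetLike.mem_coe]
        rw [hl.swap j i]
        exact neg_mem (key j i h)
  orthonormal p q := by
    rw [B_smul_left, B_smul_right]
    split_ifs with h
    · have h1 := isInvariantForm_B.rotation_self (g := g) hl (fun _ _ => Submodule.mem_top)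
        q.2.ne
      change B _ _ = B _ _ at h1
      rw [h, h1, h36]
      norm_num
    · have h1 := isInvariantForm_B.rotation_of_ne (g := g) hl (fun _ _ => Submodule.mem_top) h
      change B _ _ = 0 at h1
      rw [h1]
      simp

theorem isOrthonormalBasis_triple {A : Submodule ℝ g} {x y z : g}
    (h : IsQuaternionTriple ℝ x y z) (hspan : Submodule.span ℝ {x, y, z} = A)
    {c : ℝ} (hc : c ≠ 0) (hx : B x x = c ^ 2) :
    IsOrthonormalBasis A ![c⁻¹ • x, c⁻¹ • y, c⁻¹ • z] where
  span_eq := by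
    rw [← hspan]
    have h1 : ∀ (S : Submodule ℝ g) (w : g), c⁻¹ • w ∈ S → w ∈ S := fun S w hw => by
      simpa [smul_inv_smul₀ hc] using S.smul_mem c hw
    apply le_antisymm
    · rw [Submodule.span_le]
      rintro _ ⟨α, rfl⟩
      fin_cases α <;> exact Submodule.smul_mem _ _ (Submodule.subset_span (by simp))
    · rw [Submodule.span_le]
      rintro w (rfl | rfl | rfl)
      · exact h1 _ _ (Submodule.subset_span ⟨0, rfl⟩)
      · exact h1 _ _ (Submodule.subset_span ⟨1, rfl⟩)
      · exact h1 _ _ (Submodule.subset_span ⟨2, rfl⟩)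
  orthonormal α β := by
    obtain ⟨h1, h2, h3, h4, h5⟩ := isInvariantForm_B.triple h Submodule.mem_top Submodule.mem_top
    change B _ _ = B _ _ at h1 h2
    change B _ _ = 0 at h3 h4 h5
    have h6 : c⁻¹ * (c⁻¹ * c ^ 2) = 1 := by field_simp
    have hz : B z z = c ^ 2 := by rw [← h1, hx]
    have hy : B y y = c ^ 2 := by rw [h2, hz]
    fin_cases α <;> fin_cases β <;>
      simp [hx, hy, hz, h3, h4, h5, h6, B_comm y x, B_comm z x, B_comm z y]

/-- The sum of an invariant form over an orthonormal basis of a subalgebra of type `D₄`. -/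
theorem IsInvariantForm.sum_rotation {ι : Type*} [Fintype ι] [DecidableEq ι] {D W : Submodule ℝ g}
    {φ : LinearMap.BilinForm ℝ g} (hφ : IsInvariantForm W φ) {l : Fin 8 → Fin 8 → g}
    (hl : IsRotationFrame l) (hW : D ≤ W)
    (hspan : Submodule.span ℝ (Set.range fun p : Fin 8 × Fin 8 => l p.1 p.2) = D)
    (h36 : B (l 0 1) (l 0 1) = 36) {e : ι → g} (he : IsOrthonormalBasis D e) :
    ∑ α, φ (e α) (e α) = 28 / 36 * φ (l 0 1) (l 0 1) := by
  rw [he.sum_bilin_eq (isOrthonormalBasis_rotation hl hspan h36) φ]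
  have hlW : ∀ i j, l i j ∈ W := fun i j => hW (hspan ▸ Submodule.subset_span ⟨(i, j), rfl⟩)
  have h1 : ∀ p : {p : Fin 8 × Fin 8 // p.1 < p.2},
      φ ((6⁻¹ : ℝ) • l p.1.1 p.1.2) ((6⁻¹ : ℝ) • l p.1.1 p.1.2) = 36⁻¹ * φ (l 0 1) (l 0 1) := by
    intro p
    rw [map_smul, map_smul, LinearMap.smul_apply, hφ.rotation_self hl hlW p.2.ne, smul_eq_mul,
      smul_eq_mul]
    ring
  rw [Finset.sum_congr rfl fun p _ => h1 p, Finset.sum_const, Finset.card_univ,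
    show Fintype.card {p : Fin 8 × Fin 8 // p.1 < p.2} = 28 by decide +kernel, nsmul_eq_mul]
  push_cast
  ring

/-- The form takes the same value at all three elements of the triple, and dividing them by √72
makes them orthonormal. -/
theorem IsInvariantForm.sum_triple {ι : Type*} [Fintype ι] [DecidableEq ι] {A W : Submodule ℝ g}
    {φ : LinearMap.BilinForm ℝ g} (hφ : IsInvariantForm W φ) {x y z : g}
    (h : IsQuaternionTriple ℝ x y z) (hW : A ≤ W) (hspan : Submodule.span ℝ {x, y, z} = A)
    (h72 : B x x = 72) {e : ι → g} (he : IsOrthonormalBasis A e) :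
    ∑ α, φ (e α) (e α) = 3 / 72 * φ x x := by
  have hc : (√72 : ℝ) ^ 2 = 72 := Real.sq_sqrt (by norm_num)
  have hc0 : (√72 : ℝ) ≠ 0 := by positivity
  rw [he.sum_bilin_eq (isOrthonormalBasis_triple h hspan hc0 (h72.trans hc.symm)) φ]
  have hxA : x ∈ A := hspan ▸ Submodule.subset_span (by simp)
  have hyA : y ∈ A := hspan ▸ Submodule.subset_span (by simp)
  obtain ⟨h1, h2, -⟩ := hφ.triple h (hW hxA) (hW hyA)
  have hc' : (√72 : ℝ)⁻¹ * (√72 : ℝ)⁻¹ = 72⁻¹ := by rw [← mul_inv, ← sq, hc]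
  simp only [Fin.sum_univ_three, Matrix.cons_val, map_smul, LinearMap.smul_apply, smul_eq_mul, h2, ← h1]
  linear_combination 3 * φ x x * hc'

end E7I

/-! ### Normalised generators of the isotropy algebra -/

namespace E7I

variable {g : Type*} [LieRing g] [LieAlgebra ℝ g]

/-- Explicit generators of the ideals of the isotropy algebra of a decomposition of type `E₇`-I,
normalised by the Killing form of `g`. -/
structure IsModel (A : Fin 3 → LieSubalgebra ℝ g) (D : LieSubalgebra ℝ g)
    (m : Fin 3 → Submodule ℝ g) (x y z : Fin 3 → g) (l : Fin 8 → Fin 8 → g) : Prop where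
  triple : ∀ a, IsQuaternionTriple ℝ (x a) (y a) (z a)
  span_A : ∀ a, Submodule.span ℝ {x a, y a, z a} = (A a).toSubmodule
  frame : IsRotationFrame l
  span_D : Submodule.span ℝ (Set.range fun p : Fin 8 × Fin 8 => l p.1 p.2) = D.toSubmodule
  B_x : ∀ a, B (x a) (x a) = 72
  B_l : B (l 0 1) (l 0 1) = 36
  finrank_eq : Module.finrank ℝ g = 133
  cubed_x : ∀ a i, ∀ v ∈ m i, ⁅x a, ⁅x a, ⁅x a, v⁆⁆⁆ = -⁅x a, v⁆
  cubed_l : ∀ i, ∀ v ∈ m i, ⁅l 0 1 + l 2 3, ⁅l 0 1 + l 2 3, ⁅l 0 1 + l 2 3, v⁆⁆⁆ =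
    -⁅l 0 1 + l 2 3, v⁆

theorem A_le_isotropy (A : Fin 3 → LieSubalgebra ℝ g) (D : LieSubalgebra ℝ g) (a : Fin 3) :
    (A a).toSubmodule ≤ isotropy A D :=
  (le_iSup (fun i => (A i).toSubmodule) a).trans le_sup_left

theorem D_le_isotropy (A : Fin 3 → LieSubalgebra ℝ g) (D : LieSubalgebra ℝ g) :
    D.toSubmodule ≤ isotropy A D :=
  le_sup_right

variable [FiniteDimensional ℝ g] {A : Fin 3 → LieSubalgebra ℝ g} {D : LieSubalgebra ℝ g}
  {m : Fin 3 → Submodule ℝ g}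

/-- Rank many commuting triples are exhibited: one in each `A a`, and the self-dual and
anti-self-dual ones of so(4) on the coordinates 0–3 and on 4–7. The vector `l 0 1 + l 2 3` has
square length 72 and is a sum of two orthogonal rotations of equal length, whence 36. -/
theorem IsDecomposition.exists_isModel (h : IsDecomposition A D m) :
    ∃ x y z l, IsModel A D m x y z l := by
  choose x y z htriple hx0 hspanA using fun a =>
    exists_isQuaternionTriple_of_equiv (h.A_iso a).some
  obtain ⟨l, hl, hspanD⟩ := exists_isRotationFrame_of_equiv h.D_iso.some
  have hA : ∀ a, x a ∈ A a ∧ y a ∈ A a ∧ z a ∈ A a := fun a => by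
    have : ∀ v, v ∈ Submodule.span ℝ {x a, y a, z a} → v ∈ A a := fun v hv => by
      rwa [hspanA a] at hv
    exact ⟨this _ (Submodule.subset_span (by simp)), this _ (Submodule.subset_span (by simp)),
      this _ (Submodule.subset_span (by simp))⟩
  have hlD : ∀ i j, l i j ∈ D := fun i j => by
    have : l i j ∈ D.toSubmodule := hspanD ▸ Submodule.subset_span ⟨(i, j), rfl⟩
    exact this
  have hDA : ∀ a, ∀ u ∈ D, ∀ v ∈ A a, ⁅u, v⁆ = 0 := fun a u hu v hv => by
    rw [← lie_skew, h.lie_A_D a v hv u hu, neg_zero]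
  let X : Fin 7 → g :=
    ![x 0, x 1, x 2, l 0 1 + l 2 3, l 0 1 + l 3 2, l 4 5 + l 6 7, l 4 5 + l 7 6]
  let Y : Fin 7 → g :=
    ![y 0, y 1, y 2, l 0 2 + l 3 1, l 0 3 + l 2 1, l 4 6 + l 7 5, l 4 7 + l 6 5]
  let Z : Fin 7 → g :=
    ![z 0, z 1, z 2, -(l 0 3 + l 1 2), -(l 0 2 + l 1 3), -(l 4 7 + l 5 6), -(l 4 6 + l 5 7)]
  have hT : ∀ p, IsQuaternionTriple ℝ (X p) (Y p) (Z p) := by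
    intro p
    fin_cases p
    · exact htriple 0
    · exact htriple 1
    · exact htriple 2
    all_goals
      refine hl.isQuaternionTriple ?_ ?_ ?_ ?_ ?_ ?_ <;> decide
  have hX0 : ∀ p, X p ≠ 0 := by
    intro p
    fin_cases p
    · exact hx0 0
    · exact hx0 1
    · exact hx0 2
    · exact hl.add_ne_zero (e := 4) (by decide) (by decide) (by decide) (by decide) (by decide)
        (by decide) (by decide)
    · exact hl.add_ne_zero (e := 4) (by decide) (by decide) (by decide) (by decide) (by decide)
        (by decide) (by decide)
    · exact hl.add_ne_zero (e := 0) (by decide) (by decide) (by decide) (by decide) (by decide)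
        (by decide) (by decide)
    · exact hl.add_ne_zero (e := 0) (by decide) (by decide) (by decide) (by decide) (by decide)
        (by decide) (by decide)
  have hblock : ∀ {a b c d a' b' c' d' : Fin 8}, a < 4 ∧ b < 4 ∧ c < 4 ∧ d < 4 ∧ 4 ≤ a' ∧ 4 ≤ b' ∧
      4 ≤ c' ∧ 4 ≤ d' → ⁅l a b + l c d, l a' b' + l c' d'⁆ = 0 ∧
      ⁅l a' b' + l c' d', l a b + l c d⁆ = 0 := by
    rintro a b c d a' b' c' d' ⟨ha, hb, hc, hd, ha', hb', hc', hd'⟩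
    have h1 : ∀ {i j k n : Fin 8}, i < 4 → j < 4 → 4 ≤ k → 4 ≤ n → ⁅l i j, l k n⁆ = 0 := by
      intro i j k n hi hj hk hn
      exact hl.lie_disjoint i j k n (hi.trans_le hk).ne (hi.trans_le hn).ne (hj.trans_le hk).ne
        (hj.trans_le hn).ne
    have h2 : ⁅l a b + l c d, l a' b' + l c' d'⁆ = 0 := by
      rw [add_lie, lie_add, lie_add, h1 ha hb ha' hb', h1 ha hb hc' hd', h1 hc hd ha' hb',
        h1 hc hd hc' hd']
      simp
    exact ⟨h2, by rw [← lie_skew, h2, neg_zero]⟩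
  have hcomm : ∀ p q, p ≠ q → ⁅X p, X q⁆ = 0 ∧ ⁅X p, Y q⁆ = 0 ∧ ⁅X p, Z q⁆ = 0 := by
    have hAA : ∀ a b, a ≠ b → ⁅x a, x b⁆ = 0 ∧ ⁅x a, y b⁆ = 0 ∧ ⁅x a, z b⁆ = 0 := fun a b hab =>
      ⟨h.lie_A_A a b hab _ (hA a).1 _ (hA b).1, h.lie_A_A a b hab _ (hA a).1 _ (hA b).2.1,
        h.lie_A_A a b hab _ (hA a).1 _ (hA b).2.2⟩
    have hAD : ∀ a, ∀ u ∈ D, ∀ v ∈ D, ∀ w ∈ D, ⁅x a, u⁆ = 0 ∧ ⁅x a, v⁆ = 0 ∧ ⁅x a, -w⁆ = 0 :=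
      fun a u hu v hv w hw => ⟨h.lie_A_D a _ (hA a).1 u hu, h.lie_A_D a _ (hA a).1 v hv,
        h.lie_A_D a _ (hA a).1 _ (neg_mem hw)⟩
    have hDA' : ∀ a, ∀ u ∈ D, ⁅u, x a⁆ = 0 ∧ ⁅u, y a⁆ = 0 ∧ ⁅u, z a⁆ = 0 := fun a u hu =>
      ⟨hDA a u hu _ (hA a).1, hDA a u hu _ (hA a).2.1, hDA a u hu _ (hA a).2.2⟩
    have hl2 : ∀ i j k n, l i j + l k n ∈ D := fun i j k n => add_mem (hlD i j) (hlD k n)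
    have hX : ∀ a (q : Fin 4), ⁅x a, X (q.natAdd 3)⁆ = 0 ∧ ⁅x a, Y (q.natAdd 3)⁆ = 0 ∧
        ⁅x a, Z (q.natAdd 3)⁆ = 0 := by
      intro a q
      fin_cases q <;> exact hAD a _ (hl2 _ _ _ _) _ (hl2 _ _ _ _) _ (hl2 _ _ _ _)
    have hX' : ∀ a (q : Fin 4), ⁅X (q.natAdd 3), x a⁆ = 0 ∧ ⁅X (q.natAdd 3), y a⁆ = 0 ∧
        ⁅X (q.natAdd 3), z a⁆ = 0 := by
      intro a q
      fin_cases q <;> exact hDA' a _ (hl2 _ _ _ _)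
    have hXX : ∀ p q : Fin 4, p ≠ q → ⁅X (p.natAdd 3), X (q.natAdd 3)⁆ = 0 ∧
        ⁅X (p.natAdd 3), Y (q.natAdd 3)⁆ = 0 ∧ ⁅X (p.natAdd 3), Z (q.natAdd 3)⁆ = 0 := by
      intro p q hpq
      have hneg : ∀ {u v : g}, ⁅u, v⁆ = 0 → ⁅u, -v⁆ = 0 := fun huv => by rw [lie_neg, huv, neg_zero]
      have hb1 : ∀ {a b c d a' b' c' d' : Fin 8}, a < 4 ∧ b < 4 ∧ c < 4 ∧ d < 4 ∧ 4 ≤ a' ∧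
          4 ≤ b' ∧ 4 ≤ c' ∧ 4 ≤ d' → ⁅l a b + l c d, l a' b' + l c' d'⁆ = 0 :=
        fun hlt => (hblock hlt).1
      have hb2 : ∀ {a b c d a' b' c' d' : Fin 8}, a < 4 ∧ b < 4 ∧ c < 4 ∧ d < 4 ∧ 4 ≤ a' ∧
          4 ≤ b' ∧ 4 ≤ c' ∧ 4 ≤ d' → ⁅l a' b' + l c' d', l a b + l c d⁆ = 0 :=
        fun hlt => (hblock hlt).2
      fin_cases p <;> fin_cases q
      all_goals first
        | exact absurd rfl hpq
        | exact ⟨hb1 (by decide), hb1 (by decide), hneg (hb1 (by decide))⟩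
        | exact ⟨hb2 (by decide), hb2 (by decide), hneg (hb2 (by decide))⟩
        | exact hl.lie_self_dual_anti_self_dual (by decide) (by decide) (by decide) (by decide)
            (by decide) (by decide)
    have hcast : ∀ a : Fin 3, X (a.castAdd 4) = x a ∧ Y (a.castAdd 4) = y a ∧
        Z (a.castAdd 4) = z a := by
      intro a
      fin_cases a <;> exact ⟨rfl, rfl, rfl⟩
    intro p q
    refine Fin.addCases (m := 3) (n := 4) (fun a => ?_) (fun p' => ?_) p <;>
      refine Fin.addCases (m := 3) (n := 4) (fun b => ?_) (fun q' => ?_) q <;> intro hpq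
    · rw [(hcast a).1, (hcast b).1, (hcast b).2.1, (hcast b).2.2]
      exact hAA a b fun hab => hpq (hab ▸ rfl)
    · rw [(hcast a).1]
      exact hX a q'
    · rw [(hcast b).1, (hcast b).2.1, (hcast b).2.2]
      exact hX' b p'
    · exact hXX p' q' fun hpq' => hpq (hpq' ▸ rfl)
  obtain ⟨h133, hkey⟩ := finrank_and_B_and_cubed_of_commuting_triples h.compact h.type_E7 hT hX0
    (fun p q hpq => (hcomm p q hpq).1) (fun p q hpq => (hcomm p q hpq).2.1)
    (fun p q hpq => (hcomm p q hpq).2.2)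
  have horthA : ∀ a i, ∀ u ∈ A a, ∀ v ∈ m i, B v u = 0 := fun a i u hu v hv => by
    rw [B_comm]
    exact h.orth_isotropy i u (A_le_isotropy A D a hu) v hv
  have horthD : ∀ i, ∀ u ∈ D, ∀ v ∈ m i, B v u = 0 := fun i u hu v hv => by
    rw [B_comm]
    exact h.orth_isotropy i u (D_le_isotropy A D hu) v hv
  refine ⟨x, y, z, l, htriple, hspanA, hl, hspanD, ?_, ?_, h133, ?_, ?_⟩
  · intro a
    fin_cases a
    exacts [(hkey 0).1, (hkey 1).1, (hkey 2).1]
  · have h1 := (hkey 3).1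
    have h2 := isInvariantForm_B.rotation_add (g := g) hl (fun _ _ => Submodule.mem_top)
      (i := 0) (j := 1) (k := 2) (m := 3) (by decide) (by decide) (by decide) (by decide)
      (by decide)
    change B _ _ = 2 * B _ _ at h2
    change B (l 0 1 + l 2 3) (l 0 1 + l 2 3) = 72 at h1
    linarith
  · intro a i v hv
    fin_cases a
    · exact (hkey 0).2 v (horthA 0 i _ (hA 0).2.1 v hv) (horthA 0 i _ (hA 0).2.2 v hv)
    · exact (hkey 1).2 v (horthA 1 i _ (hA 1).2.1 v hv) (horthA 1 i _ (hA 1).2.2 v hv)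
    · exact (hkey 2).2 v (horthA 2 i _ (hA 2).2.1 v hv) (horthA 2 i _ (hA 2).2.2 v hv)
  · intro i v hv
    exact (hkey 3).2 v (horthD i _ (add_mem (hlD _ _) (hlD _ _)) v hv)
      (horthD i _ (neg_mem (add_mem (hlD _ _) (hlD _ _))) v hv)

end E7I

/-! ### Sum rules, symmetry and vanishing of the bracket sums -/

namespace E7I

variable {g : Type*} [LieRing g] [LieAlgebra ℝ g]

theorem IsOrthonormalBasis.adForm_self {ι : Type*} [Fintype ι] [DecidableEq ι]
    [FiniteDimensional ℝ g] {e : ι → g} (he : IsOrthonormalBasis ⊤ e) (x : g) :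
    adForm e x x = B x x := by
  have h1 : LinearMap.trace ℝ g (LieAlgebra.ad ℝ g x ∘ₗ LieAlgebra.ad ℝ g x) =
      ∑ α, B ⁅x, ⁅x, e α⁆⁆ (e α) := by
    rw [← LinearMap.trace_conj' (LieAlgebra.ad ℝ g x ∘ₗ LieAlgebra.ad ℝ g x)
      (Submodule.topEquiv (R := ℝ) (M := g)).symm, he.trace_eq]
    rfl
  rw [adForm_apply, B, killingForm_apply_apply, h1, ← Finset.sum_neg_distrib]
  refine Finset.sum_congr rfl fun α _ => ?_
  rw [B_lie_skew x ⁅x, e α⁆, neg_neg]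

namespace IsAdaptedBasis

variable {V : Fin 8 → Submodule ℝ g} {d : Fin 8 → ℕ} {e : (i : Fin 8) → Fin (d i) → g}
  (he : IsAdaptedBasis V e)
include he

theorem isOrthonormalBasis (i : Fin 8) : IsOrthonormalBasis (V i) (e i) :=
  ⟨he.span_eq i, he.orthonormal i⟩

theorem isOrthonormalBasis_sigma (horth : ∀ i j, i ≠ j → ∀ x ∈ V i, ∀ y ∈ V j, B x y = 0)
    (hsup : ⨆ i, V i = ⊤) :
    IsOrthonormalBasis ⊤ fun p : Σ i, Fin (d i) => e p.1 p.2 where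
  span_eq := by
    rw [Set.range_sigma_eq_iUnion_range, Submodule.span_iUnion, ← hsup]
    exact iSup_congr he.span_eq
  orthonormal := by
    rintro ⟨i, α⟩ ⟨j, β⟩
    rcases eq_or_ne i j with rfl | hij
    · simp [he.orthonormal]
    · rw [if_neg fun h => hij (congrArg Sigma.fst h)]
      exact horth i j hij _ ((he.isOrthonormalBasis i).mem α) _ ((he.isOrthonormalBasis j).mem β)

theorem finrank_eq_sum (horth : ∀ i j, i ≠ j → ∀ x ∈ V i, ∀ y ∈ V j, B x y = 0)
    (hsup : ⨆ i, V i = ⊤) : Module.finrank ℝ g = ∑ i, d i := by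
  have := (he.isOrthonormalBasis_sigma horth hsup).card_eq_finrank
  simpa using this.symm

theorem B_self_eq_sum [FiniteDimensional ℝ g]
    (horth : ∀ i j, i ≠ j → ∀ x ∈ V i, ∀ y ∈ V j, B x y = 0)
    (hsup : ⨆ i, V i = ⊤) (x : g) : B x x = ∑ j, adForm (e j) x x := by
  rw [← (he.isOrthonormalBasis_sigma horth hsup).adForm_self]
  simp only [adForm_apply]
  rw [Fintype.sum_sigma]

/-- Each of the `d i` unit vectors u of the i-th basis satisfies 1 = B(u, u) = -tr (ad u)², and this
trace is expanded in the full adapted basis. -/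
theorem sum_quantity [FiniteDimensional ℝ g]
    (horth : ∀ i j, i ≠ j → ∀ x ∈ V i, ∀ y ∈ V j, B x y = 0)
    (hsup : ⨆ i, V i = ⊤) (i : Fin 8) : ∑ j, ∑ k, quantity e i j k = d i := by
  have h1 : ∀ α, ∑ j, ∑ k, ∑ β, ∑ γ, B ⁅e i α, e j β⁆ (e k γ) ^ 2 = 1 := by
    intro α
    have h2 : B (e i α) (e i α) = 1 := by rw [he.orthonormal, if_pos rfl]
    rw [← h2, he.B_self_eq_sum horth hsup]
    refine Finset.sum_congr rfl fun j _ => ?_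
    rw [Finset.sum_comm, adForm_apply]
    refine Finset.sum_congr rfl fun β _ => ?_
    rw [← (he.isOrthonormalBasis_sigma horth hsup).sum_B_sq Submodule.mem_top, Fintype.sum_sigma]
  simp only [quantity]
  simp_rw [Finset.sum_comm (s := Finset.univ) (t := (Finset.univ : Finset (Fin (d i)))), h1]
  simp

/-- As the brackets lie in `V k`, Parseval turns the innermost sum into a square length. -/
theorem quantity_eq_sum_adForm {i j k : Fin 8} (h : ∀ x ∈ V i, ∀ y ∈ V j, ⁅x, y⁆ ∈ V k) :
    quantity e i j k = ∑ α, adForm (e j) (e i α) (e i α) :=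
  Finset.sum_congr rfl fun α _ => Finset.sum_congr rfl fun β _ =>
    (he.isOrthonormalBasis k).sum_B_sq
      (h _ ((he.isOrthonormalBasis i).mem α) _ ((he.isOrthonormalBasis j).mem β))

theorem quantity_eq_zero {i j k : Fin 8} (h : ∀ x ∈ V i, ∀ y ∈ V j, ∀ z ∈ V k, B ⁅x, y⁆ z = 0) :
    quantity e i j k = 0 :=
  Finset.sum_eq_zero fun α _ => Finset.sum_eq_zero fun β _ => Finset.sum_eq_zero fun γ _ => by
    rw [h _ ((he.isOrthonormalBasis i).mem α) _ ((he.isOrthonormalBasis j).mem β) _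
      ((he.isOrthonormalBasis k).mem γ), sq, zero_mul]

end IsAdaptedBasis

section

variable {d : Fin 8 → ℕ} (e : (i : Fin 8) → Fin (d i) → g)

theorem quantity_swap_left (i j k : Fin 8) : quantity e i j k = quantity e j i k := by
  rw [quantity, quantity, Finset.sum_comm]
  refine Finset.sum_congr rfl fun β _ => Finset.sum_congr rfl fun α _ =>
    Finset.sum_congr rfl fun γ _ => ?_
  rw [← lie_skew, B_neg_left, neg_sq]

theorem quantity_swap_right (i j k : Fin 8) : quantity e i j k = quantity e i k j := by
  rw [quantity, quantity]
  refine Finset.sum_congr rfl fun α _ => ?_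
  rw [Finset.sum_comm]
  refine Finset.sum_congr rfl fun γ _ => Finset.sum_congr rfl fun β _ => ?_
  rw [B_lie_skew, neg_sq, B_comm]

end

/-- Up to order, the index triples that the bracket relations of a decomposition of type `E₇`-I
allow to be nonzero. -/
def admissibleTriples : List (Fin 8 × Fin 8 × Fin 8) :=
  [(1, 1, 1), (2, 2, 2), (3, 3, 3), (4, 4, 4), (5, 6, 7), (1, 5, 5), (1, 6, 6), (1, 7, 7),
    (2, 5, 5), (2, 6, 6), (2, 7, 7), (3, 5, 5), (3, 6, 6), (3, 7, 7), (4, 5, 5), (4, 6, 6),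
    (4, 7, 7)]

namespace IsDecomposition

variable [FiniteDimensional ℝ g] {A : Fin 3 → LieSubalgebra ℝ g} {D : LieSubalgebra ℝ g}
  {m : Fin 3 → Submodule ℝ g}

variable (h : IsDecomposition A D m)
include h

omit h [FiniteDimensional ℝ g] in
theorem summand_le_isotropy {i : Fin 8} (hi : i ≤ 4) : summand A D m i ≤ isotropy A D := by
  fin_cases i
  · exact bot_le
  · exact A_le_isotropy A D 0
  · exact A_le_isotropy A D 1
  · exact A_le_isotropy A D 2
  · exact D_le_isotropy A D
  all_goals exact absurd hi (by decide)

omit h [FiniteDimensional ℝ g] in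
theorem summand_natAdd (p : Fin 3) : summand A D m (p.natAdd 5) = m p := by
  fin_cases p <;> rfl

theorem lie_summand {i j : Fin 8} (hij : i < j) (hj : j ≤ 4) {x y : g} (hx : x ∈ summand A D m i)
    (hy : y ∈ summand A D m j) : ⁅x, y⁆ = 0 := by
  fin_cases i
  · rw [(Submodule.mem_bot ℝ).mp hx, zero_lie]
  all_goals
    fin_cases j <;> first
      | exact absurd hij (by decide)
      | exact absurd hj (by decide)
      | exact h.lie_A_A _ _ (by decide) _ hx _ hy
      | exact h.lie_A_D _ _ hx _ hy

omit h [FiniteDimensional ℝ g] in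
theorem exists_summand_eq {i : Fin 8} (hi : 5 ≤ i) : ∃ p : Fin 3, i = p.natAdd 5 := by
  decide +revert

theorem orthogonal_isotropy_summand {j : Fin 8} (hj : 5 ≤ j) {x y : g} (hx : x ∈ isotropy A D)
    (hy : y ∈ summand A D m j) : B x y = 0 := by
  obtain ⟨p, rfl⟩ := exists_summand_eq hj
  rw [summand_natAdd] at hy
  exact h.orth_isotropy p x hx y hy

theorem orthogonal_summand_of_le {i j : Fin 8} (hi : i ≤ 4) (hj : 5 ≤ j) {x y : g}
    (hx : x ∈ summand A D m i) (hy : y ∈ summand A D m j) : B x y = 0 :=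
  h.orthogonal_isotropy_summand hj (summand_le_isotropy hi hx) hy

theorem lie_mem_summand_of_le {i j : Fin 8} (hi : i ≤ 4) (hj : 5 ≤ j) {x y : g}
    (hx : x ∈ summand A D m i) (hy : y ∈ summand A D m j) : ⁅x, y⁆ ∈ summand A D m j := by
  obtain ⟨p, rfl⟩ := exists_summand_eq hj
  rw [summand_natAdd] at hy ⊢
  exact h.invariant p x (summand_le_isotropy hi hx) y hy

theorem orthogonal_summand_of_ne {i j : Fin 8} (hi : 5 ≤ i) (hj : 5 ≤ j) (hij : i ≠ j) {x y : g}
    (hx : x ∈ summand A D m i) (hy : y ∈ summand A D m j) : B x y = 0 := by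
  obtain ⟨p, rfl⟩ := exists_summand_eq hi
  obtain ⟨q, rfl⟩ := exists_summand_eq hj
  rw [summand_natAdd] at hx hy
  exact h.orth_m p q (fun hpq => hij (hpq ▸ rfl)) x hx y hy

theorem lie_self_mem_isotropy {i : Fin 8} (hi : 5 ≤ i) {x y : g} (hx : x ∈ summand A D m i)
    (hy : y ∈ summand A D m i) : ⁅x, y⁆ ∈ isotropy A D := by
  obtain ⟨p, rfl⟩ := exists_summand_eq hi
  rw [summand_natAdd] at hx hy
  exact h.lie_self p x hx y hy

/-- Between ideals of the isotropy algebra, orthogonality follows from commutation: every generator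
of `A a` is half a bracket [p, q], and B([p, q], v) = B(p, [q, v]) = 0. For two different nonzero
ideals the one of smaller index is some `A a`. -/
theorem orthogonal_summand {x y z : Fin 3 → g} {l : Fin 8 → Fin 8 → g}
    (hM : IsModel A D m x y z l) {i j : Fin 8} (hij : i ≠ j) :
    ∀ u ∈ summand A D m i, ∀ v ∈ summand A D m j, B u v = 0 := by
  have key : ∀ a, ∀ v, (∀ u ∈ A a, ⁅u, v⁆ = 0) → ∀ u ∈ A a, B u v = 0 := by
    intro a v hv u hu
    have hT := hM.triple a
    have hsub : ∀ u, u ∈ ({x a, y a, z a} : Set g) → ⁅u, v⁆ = 0 := fun u hu =>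
      hv u ((hM.span_A a).le (Submodule.subset_span hu))
    have hz : ⁅z a, v⁆ = 0 := hsub _ (by simp)
    have hx : ⁅x a, v⁆ = 0 := hsub _ (by simp)
    have hy : ⁅y a, v⁆ = 0 := hsub _ (by simp)
    have h0 : ∀ p q r : g, ⁅p, q⁆ = (2 : ℝ) • r → ⁅q, v⁆ = 0 → B r v = 0 := fun p q r hpq hq => by
      have := B_lie_left p q v
      rw [hpq, hq, B_zero_right, B_smul_left] at this
      linarith
    replace hu : u ∈ Submodule.span ℝ {x a, y a, z a} := (hM.span_A a).ge hu
    induction hu using Submodule.span_induction with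
    | zero => exact B_zero_left v
    | add p q _ _ hp hq => rw [B_add_left, hp, hq, add_zero]
    | smul c p _ hp => rw [B_smul_left, hp, mul_zero]
    | mem p hp =>
      rcases hp with rfl | rfl | rfl
      · exact h0 _ _ _ hT.lie_y_z hz
      · exact h0 _ _ _ hT.lie_z_x hx
      · exact h0 _ _ _ hT.lie_x_y hy
  have hlt : ∀ i j : Fin 8, i < j → ∀ u ∈ summand A D m i, ∀ v ∈ summand A D m j, B u v = 0 := by
    intro i j hij u hu v hv
    rcases le_or_gt j 4 with hj | hj
    · have hcomm : ∀ w ∈ summand A D m i, ⁅w, v⁆ = 0 := fun w hw => h.lie_summand hij hj hw hv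
      fin_cases i
      · rw [(Submodule.mem_bot ℝ).mp hu, B_zero_left]
      · exact key 0 v hcomm u hu
      · exact key 1 v hcomm u hu
      · exact key 2 v hcomm u hu
      all_goals exact absurd (lt_of_lt_of_le hij hj) (by decide)
    · replace hj : 5 ≤ j := hj
      rcases le_or_gt i 4 with hi | hi
      · exact h.orthogonal_summand_of_le hi hj hu hv
      · exact h.orthogonal_summand_of_ne hi hj hij.ne hu hv
  intro u hu v hv
  rcases hij.lt_or_gt with hij | hij
  · exact hlt i j hij u hu v hv
  · rw [B_comm]
    exact hlt j i hij v hv u hu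

theorem iSup_summand : ⨆ i, summand A D m i = ⊤ := by
  rw [eq_top_iff, ← h.sup_eq_top]
  have hle : ∀ i, summand A D m i ≤ ⨆ i, summand A D m i := le_iSup _
  refine sup_le (sup_le (iSup_le fun a => ?_) (hle 4)) (iSup_le fun p => ?_)
  · fin_cases a
    exacts [hle 1, hle 2, hle 3]
  · fin_cases p
    exacts [hle 5, hle 6, hle 7]

/-- Three causes of vanishing: different ideals commute (`h1`), the isotropy algebra preserves each
m_i (`h2`), and [m_i, m_i] is orthogonal to every m_j (`h3`). Three different indices above 4 can
only be 5, 6, 7, which is admissible. -/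
theorem quantity_eq_zero_of_notMem {d : Fin 8 → ℕ} {e : (i : Fin 8) → Fin (d i) → g}
    (he : IsAdaptedBasis (summand A D m) e) {i j k : Fin 8} (hij : i ≤ j) (hjk : j ≤ k)
    (hijk : (i, j, k) ∉ admissibleTriples) : quantity e i j k = 0 := by
  have h1 : ∀ {p q r : Fin 8}, p < q → q ≤ 4 → quantity e p q r = 0 := fun hij hj =>
    he.quantity_eq_zero fun x hx y hy z _ => by rw [h.lie_summand hij hj hx hy, B_zero_left]
  have h2 : ∀ {p q r : Fin 8}, p ≤ 4 → 5 ≤ q → r ≠ q → quantity e p q r = 0 := fun {_ _ r} hi hj hk =>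
    he.quantity_eq_zero fun x hx y hy z hz => by
      have hxy := h.lie_mem_summand_of_le hi hj hx hy
      rcases le_or_gt r 4 with hk' | hk'
      · rw [B_comm]
        exact h.orthogonal_summand_of_le hk' hj hz hxy
      · exact h.orthogonal_summand_of_ne hj hk' hk.symm hxy hz
  have h3 : ∀ {p q : Fin 8}, 5 ≤ p → 5 ≤ q → quantity e p p q = 0 := fun hi hj =>
    he.quantity_eq_zero fun x hx y hy z hz =>
      h.orthogonal_isotropy_summand hj (h.lie_self_mem_isotropy hi hx hy) hz
  rcases le_or_gt k 4 with hk | hk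
  · rcases hij.lt_or_eq with hij | rfl
    · exact h1 hij (hjk.trans hk)
    rcases hjk.lt_or_eq with hjk | rfl
    · rw [quantity_swap_right]
      exact h1 hjk hk
    · obtain rfl : i = 0 := by revert hijk; revert i; decide
      exact he.quantity_eq_zero fun x hx y _ z _ => by
        rw [(Submodule.mem_bot ℝ).mp hx, zero_lie, B_zero_left]
  replace hk : 5 ≤ k := hk
  rcases le_or_gt i 4 with hi | hi
  · rcases eq_or_ne k j with rfl | hkj
    · obtain rfl : i = 0 := by revert hijk; revert i k; decide
      exact he.quantity_eq_zero fun x hx y _ z _ => by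
        rw [(Submodule.mem_bot ℝ).mp hx, zero_lie, B_zero_left]
    · rw [quantity_swap_right]
      exact h2 hi hk hkj.symm
  · replace hi : 5 ≤ i := hi
    rcases hij.lt_or_eq with hij | rfl
    · rcases hjk.lt_or_eq with hjk | rfl
      · exfalso
        clear h1 h2 h3
        revert i j k
        decide
      · rw [quantity_swap_left, quantity_swap_right]
        exact h3 hk hi
    · exact h3 hi hk

end IsDecomposition

end E7I

/-! ### The ideals acting on themselves and on the isotropy summands -/

namespace E7I

variable {g : Type*} [LieRing g] [LieAlgebra ℝ g]

theorem IsOrthonormalBasis.adForm_eq {ι κ : Type*} [Fintype ι] [DecidableEq ι] [Fintype κ]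
    [DecidableEq κ] {V : Submodule ℝ g} {e : ι → g} {f : κ → g} (he : IsOrthonormalBasis V e)
    (hf : IsOrthonormalBasis V f) (x : g) : adForm e x x = adForm f x x :=
  he.sum_bilin_eq hf
    ((-killingForm ℝ g).compl₁₂ (LieAlgebra.ad ℝ g x : g →ₗ[ℝ] g) (LieAlgebra.ad ℝ g x : g →ₗ[ℝ] g))

theorem adForm_eq_zero {ι : Type*} [Fintype ι] {e : ι → g} {x : g} (h : ∀ α, ⁅x, e α⁆ = 0) :
    adForm e x x = 0 :=
  Finset.sum_eq_zero fun α _ => by rw [h, B_zero_left]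

/-- The unit vectors along y and z are sent by ad x to vectors of square length 4, so the sum is 4 +
4. -/
theorem IsQuaternionTriple.adForm_self {ι : Type*} [Fintype ι] [DecidableEq ι]
    {A : Submodule ℝ g} {x y z : g} (h : IsQuaternionTriple ℝ x y z)
    (hspan : Submodule.span ℝ {x, y, z} = A) (h72 : B x x = 72) {e : ι → g}
    (he : IsOrthonormalBasis A e) : adForm e x x = 8 := by
  have hc : (√72 : ℝ) ^ 2 = 72 := Real.sq_sqrt (by norm_num)
  have hc0 : (√72 : ℝ) ≠ 0 := by positivity
  have hc' : (√72 : ℝ)⁻¹ * (√72 : ℝ)⁻¹ = 72⁻¹ := by rw [← mul_inv, ← sq, hc]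
  obtain ⟨h1, h2, -⟩ := isInvariantForm_B.triple h Submodule.mem_top Submodule.mem_top
  change B _ _ = B _ _ at h1 h2
  rw [he.adForm_eq (isOrthonormalBasis_triple h hspan hc0 (h72.trans hc.symm)), adForm_apply]
  simp only [Fin.sum_univ_three, Matrix.cons_val, lie_smul, lie_self, h.lie_x_y, h.lie_x_z,
    B_smul_left, B_smul_right, B_neg_left, B_neg_right, smul_zero, B_zero_left, h2, ← h1, h72]
  linear_combination 576 * hc'

/-- Exactly the twelve rotations sharing one index with `l 0 1` contribute, and each normalised one
goes to a unit vector. -/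
theorem IsRotationFrame.adForm_self {ι : Type*} [Fintype ι] [DecidableEq ι]
    {D : Submodule ℝ g} {l : Fin 8 → Fin 8 → g} (hl : IsRotationFrame l)
    (hspan : Submodule.span ℝ (Set.range fun p : Fin 8 × Fin 8 => l p.1 p.2) = D)
    (h36 : B (l 0 1) (l 0 1) = 36) {e : ι → g} (he : IsOrthonormalBasis D e) :
    adForm e (l 0 1) (l 0 1) = 12 := by
  rw [he.adForm_eq (isOrthonormalBasis_rotation hl hspan h36), adForm_apply]
  have hB : ∀ {i j : Fin 8}, i ≠ j → B (l i j) (l i j) = 36 := fun hij =>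
    (isInvariantForm_B.rotation_self (g := g) hl (fun _ _ => Submodule.mem_top) hij).trans h36
  have h1 : ∀ p : {p : Fin 8 × Fin 8 // p.1 < p.2},
      B ⁅l 0 1, (6⁻¹ : ℝ) • l p.1.1 p.1.2⁆ ⁅l 0 1, (6⁻¹ : ℝ) • l p.1.1 p.1.2⁆ =
        if p.1.1 ≤ 1 ∧ 1 < p.1.2 then 1 else 0 := by
    rintro ⟨⟨i, j⟩, hij⟩
    simp only at hij ⊢
    have h2 : B ⁅l 0 1, l i j⁆ ⁅l 0 1, l i j⁆ = if i ≤ 1 ∧ 1 < j then 36 else 0 := by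
      by_cases hi : i ≤ 1
      · by_cases hj : 1 < j
        · rw [if_pos ⟨hi, hj⟩]
          obtain rfl | rfl : i = 0 ∨ i = 1 := by clear hij; decide +revert
          · rw [hl.lie_left_left (by decide) hj.ne hij.ne, B_neg_left, B_neg_right, hB hj.ne]
            norm_num
          · rw [hl.lie_of_ne 0 1 j (by decide) hj.ne (by rintro rfl; exact absurd hj (by decide)),
              hB (by rintro rfl; exact absurd hj (by decide))]
        · obtain ⟨rfl, rfl⟩ : i = 0 ∧ j = 1 := by clear hB; decide +revert
          simp
      · rw [if_neg fun h => hi h.1, hl.lie_disjoint 0 1 i j, B_zero_left] <;>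
        · rintro rfl
          revert hi hij
          decide +revert
    rw [lie_smul, B_smul_left, B_smul_right, h2]
    split_ifs <;> norm_num
  rw [Finset.sum_congr rfl fun p _ => h1 p, Finset.sum_boole,
    show (Finset.univ.filter fun p : {p : Fin 8 × Fin 8 // p.1 < p.2} =>
      p.1.1 ≤ 1 ∧ 1 < p.1.2).card = 12 by decide +kernel]
  norm_num

namespace IsDecomposition

variable [FiniteDimensional ℝ g] {A : Fin 3 → LieSubalgebra ℝ g} {D : LieSubalgebra ℝ g}
  {m : Fin 3 → Submodule ℝ g} (h : IsDecomposition A D m)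
include h

theorem lie_mem_of_mem_isotropy {a : Fin 3} {u w : g} (hu : u ∈ A a) (hw : w ∈ isotropy A D) :
    ⁅u, w⁆ ∈ A a := by
  have : isotropy A D ≤ (A a).toSubmodule.comap (LieAlgebra.ad ℝ g u : g →ₗ[ℝ] g) := by
    refine sup_le (iSup_le fun b v hv => ?_) fun v hv => ?_
    · rcases eq_or_ne a b with rfl | hab
      · exact (A a).lie_mem hu hv
      · change ⁅u, v⁆ ∈ A a
        rw [h.lie_A_A a b hab u hu v hv]
        exact zero_mem _
    · change ⁅u, v⁆ ∈ A a
      rw [h.lie_A_D a u hu v hv]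
      exact zero_mem _
  exact this hw

/-- An ideal of type `A₁` acts on each isotropy summand trivially or through spin `1/2`. -/
theorem lie_eq_zero_or_lie_lie_eq_neg {x y z : Fin 3 → g} {l : Fin 8 → Fin 8 → g}
    (hM : IsModel A D m x y z l) (a i : Fin 3) :
    (∀ u ∈ A a, ∀ v ∈ m i, ⁅u, v⁆ = 0) ∨ ∀ v ∈ m i, ⁅x a, ⁅x a, v⁆⁆ = -v := by
  -- The vectors of `m i` killed by `A a` form an invariant subspace because `A a` is an ideal;
  -- irreducibility makes it zero or everything.
  let N : Submodule ℝ g :=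
    { carrier := {v | v ∈ m i ∧ ∀ u ∈ A a, ⁅u, v⁆ = 0}
      add_mem' := fun ⟨hv, hv'⟩ ⟨hw, hw'⟩ => ⟨add_mem hv hw, fun u hu => by
        rw [lie_add, hv' u hu, hw' u hu, add_zero]⟩
      zero_mem' := ⟨zero_mem _, fun u _ => lie_zero u⟩
      smul_mem' := fun c v ⟨hv, hv'⟩ => ⟨Submodule.smul_mem _ c hv, fun u hu => by
        rw [lie_smul, hv' u hu, smul_zero]⟩ }
  have hN : ∀ w ∈ isotropy A D, ∀ v ∈ N, ⁅w, v⁆ ∈ N := fun w hw v hv =>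
    ⟨h.invariant i w hw v hv.1, fun u hu => by
      rw [leibniz_lie, hv.2 u hu, lie_zero, hv.2 _ (h.lie_mem_of_mem_isotropy hu hw), add_zero]⟩
  rcases h.irreducible i N (fun v hv => hv.1) hN with hbot | htop
  · right
    intro v hv
    have hT := hM.triple a
    have hsub : ∀ u, u ∈ ({x a, y a, z a} : Set g) → u ∈ A a := fun u hu =>
      (hM.span_A a).le (Submodule.subset_span hu)
    have hmem : ∀ u, u ∈ ({x a, y a, z a} : Set g) → ∀ v ∈ m i, ⁅u, v⁆ ∈ m i := fun u hu =>
      h.invariant i u (A_le_isotropy A D a (hsub u hu))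
    -- If ad x kills v, it acts on the span of [y, v] and [z, v] with square -4. The cubic relation
    -- allows only 0 and -1 as eigenvalues of the square, so both vectors vanish and v is killed by
    -- `A a`.
    have hker : ∀ v ∈ m i, ⁅x a, v⁆ = 0 → v = 0 := by
      intro v hv hxv
      suffices v ∈ N by simpa [hbot] using this
      have h1 : ⁅x a, ⁅y a, v⁆⁆ = (2 : ℝ) • ⁅z a, v⁆ := by
        rw [leibniz_lie, hT.lie_x_y, hxv, lie_zero, add_zero, smul_lie]
      have h2 : ⁅x a, ⁅z a, v⁆⁆ = -((2 : ℝ) • ⁅y a, v⁆) := by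
        rw [leibniz_lie, hT.lie_x_z, hxv, lie_zero, add_zero, neg_lie, smul_lie]
      have h3 := hM.cubed_x a i _ (hmem (y a) (by simp) v hv)
      rw [h1, lie_smul, h2, lie_smul, lie_neg, lie_smul, h1] at h3
      have hz : ⁅z a, v⁆ = 0 := by
        linear_combination (norm := module) (-(1 / 6) : ℝ) • h3
      have hy : ⁅y a, v⁆ = 0 := by
        rw [hz, lie_zero] at h2
        linear_combination (norm := module) (1 / 2 : ℝ) • h2
      refine ⟨hv, fun u hu => ?_⟩
      replace hu : u ∈ Submodule.span ℝ {x a, y a, z a} := (hM.span_A a).ge hu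
      induction hu using Submodule.span_induction with
      | zero => exact zero_lie v
      | add p q _ _ hp hq => rw [add_lie, hp, hq, add_zero]
      | smul c p _ hp => rw [smul_lie, hp, smul_zero]
      | mem p hp => rcases hp with rfl | rfl | rfl <;> assumption
    have hx := hmem (x a) (by simp)
    refine eq_neg_of_add_eq_zero_left (hker _ (add_mem (hx _ (hx v hv)) hv) ?_)
    rw [lie_add, hM.cubed_x a i v hv, neg_add_cancel]
  · left
    intro u hu v hv
    rw [← htop] at hv
    exact hv.2 u hu

end IsDecomposition

end E7I

/-! ### Traces of the generators on the summands -/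

namespace E7I

variable {g : Type*} [LieRing g] [LieAlgebra ℝ g]

/-- If `ad w` satisfies `t ^ 3 + t = 0` on `V`, then `-(ad w) ^ 2` is a projection of `V`, so that
its trace is a natural number. -/
theorem IsOrthonormalBasis.exists_nat_adForm_eq {ι : Type*} [Fintype ι] [DecidableEq ι]
    [FiniteDimensional ℝ g] {V : Submodule ℝ g} {e : ι → g} (he : IsOrthonormalBasis V e) {w : g}
    (hw : ∀ v ∈ V, ⁅w, v⁆ ∈ V) (hcubed : ∀ v ∈ V, ⁅w, ⁅w, ⁅w, v⁆⁆⁆ = -⁅w, v⁆) :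
    ∃ n : ℕ, adForm e w w = n := by
  let f : V →ₗ[ℝ] V := (LieAlgebra.ad ℝ g w : g →ₗ[ℝ] g).restrict hw
  have hf : IsIdempotentElem (-(f * f)) := by
    ext v
    change -⁅w, ⁅w, -⁅w, ⁅w, (v : g)⁆⁆⁆⁆ = -⁅w, ⁅w, (v : g)⁆⁆
    rw [lie_neg, lie_neg, hcubed _ (hw v v.2), neg_neg]
  refine ⟨Module.finrank ℝ (LinearMap.range (-(f * f))), ?_⟩
  rw [← (LinearMap.IsIdempotentElem.isProj_range _ hf).trace, he.trace_eq, adForm_apply]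
  refine Finset.sum_congr rfl fun α _ => ?_
  change _ = B (-⁅w, ⁅w, e α⁆⁆) (e α)
  rw [B_neg_left, B_lie_skew w ⁅w, e α⁆, neg_neg]

namespace IsDecomposition

variable [FiniteDimensional ℝ g] {A : Fin 3 → LieSubalgebra ℝ g} {D : LieSubalgebra ℝ g}
  {m : Fin 3 → Submodule ℝ g} (h : IsDecomposition A D m) {d : Fin 8 → ℕ}
  {e : (i : Fin 8) → Fin (d i) → g} (he : IsAdaptedBasis (summand A D m) e)
  {x y z : Fin 3 → g} {l : Fin 8 → Fin 8 → g} (hM : IsModel A D m x y z l)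

omit [FiniteDimensional ℝ g] in
theorem summand_succ_castAdd (A : Fin 3 → LieSubalgebra ℝ g) (D : LieSubalgebra ℝ g)
    (m : Fin 3 → Submodule ℝ g) (a : Fin 3) :
    summand A D m (a.succ.castAdd 4) = (A a).toSubmodule := by
  fin_cases a <;> rfl

include h he hM

omit [FiniteDimensional ℝ g] h hM in
theorem isOrthonormalBasis_A (a : Fin 3) :
    IsOrthonormalBasis (A a).toSubmodule (e (a.succ.castAdd 4)) := by
  have := he.isOrthonormalBasis (a.succ.castAdd 4)
  rwa [summand_succ_castAdd] at this

omit [FiniteDimensional ℝ g] h hM in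
theorem isOrthonormalBasis_D : IsOrthonormalBasis D.toSubmodule (e 4) :=
  he.isOrthonormalBasis 4

omit [FiniteDimensional ℝ g] h hM in
theorem isOrthonormalBasis_m (i : Fin 3) : IsOrthonormalBasis (m i) (e (i.natAdd 5)) := by
  have := he.isOrthonormalBasis (i.natAdd 5)
  rwa [summand_natAdd] at this

omit [FiniteDimensional ℝ g] h hM in
theorem dim_zero : d 0 = 0 := by
  by_contra hd
  let α : Fin (d 0) := ⟨0, Nat.pos_of_ne_zero hd⟩
  have h1 := he.orthonormal 0 α α
  rw [(Submodule.mem_bot ℝ).mp ((he.isOrthonormalBasis 0).mem α), B_zero_left, if_pos rfl] at h1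
  exact zero_ne_one h1

omit [FiniteDimensional ℝ g] h in
theorem dim_A (a : Fin 3) : d (a.succ.castAdd 4) = 3 := by
  have hc : (√72 : ℝ) ^ 2 = 72 := Real.sq_sqrt (by norm_num)
  have h1 := (isOrthonormalBasis_A he a).card_eq_finrank
  rw [← (isOrthonormalBasis_triple (hM.triple a) (hM.span_A a) (by positivity)
    ((hM.B_x a).trans hc.symm)).card_eq_finrank] at h1
  simpa using h1

omit [FiniteDimensional ℝ g] h in
theorem dim_D : d 4 = 28 := by
  have h1 := (isOrthonormalBasis_D he).card_eq_finrank
  rw [← (isOrthonormalBasis_rotation hM.frame hM.span_D hM.B_l).card_eq_finrank,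
    show Fintype.card {p : Fin 8 × Fin 8 // p.1 < p.2} = 28 by decide +kernel] at h1
  simpa using h1

theorem sum_dim_m : d 5 + d 6 + d 7 = 96 := by
  have h1 := he.finrank_eq_sum (fun i j hij => h.orthogonal_summand hM hij) h.iSup_summand
  rw [hM.finrank_eq, Fin.sum_univ_eight, dim_zero he, dim_D he hM] at h1
  have h2 : d 1 = 3 := dim_A he hM 0
  have h3 : d 2 = 3 := dim_A he hM 1
  have h4 : d 3 = 3 := dim_A he hM 2
  omega

omit hM in
theorem dim_m_pos (i : Fin 3) :
    0 < d (i.natAdd 5) := by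
  have h1 := (isOrthonormalBasis_m he i).card_eq_finrank
  rw [Fintype.card_fin] at h1
  rw [h1]
  have := Submodule.nontrivial_iff_ne_bot.mpr (h.ne_bot i)
  exact Module.finrank_pos

omit hM in
theorem isInvariantForm_adForm_m (i : Fin 3) :
    IsInvariantForm (isotropy A D) (adForm (e (i.natAdd 5))) :=
  isInvariantForm_adForm (isOrthonormalBasis_m he i) (h.invariant i)

omit [FiniteDimensional ℝ g] h in
theorem quantity_A_A_A (a : Fin 3) :
    quantity e (a.succ.castAdd 4) (a.succ.castAdd 4) (a.succ.castAdd 4) = 1 / 3 := by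
  have hA := isOrthonormalBasis_A he a
  have hmem : ∀ u ∈ (A a).toSubmodule, ∀ v ∈ (A a).toSubmodule, ⁅u, v⁆ ∈ (A a).toSubmodule :=
    fun u hu v hv => (A a).lie_mem hu hv
  rw [he.quantity_eq_sum_adForm (by rwa [summand_succ_castAdd]),
    (isInvariantForm_adForm hA hmem).sum_triple (hM.triple a) le_rfl (hM.span_A a) (hM.B_x a) hA,
    (hM.triple a).adForm_self (hM.span_A a) (hM.B_x a) hA]
  norm_num

omit [FiniteDimensional ℝ g] h in
theorem quantity_D_D_D : quantity e 4 4 4 = 28 / 3 := by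
  have hD := isOrthonormalBasis_D he
  have hmem : ∀ u ∈ D.toSubmodule, ∀ v ∈ D.toSubmodule, ⁅u, v⁆ ∈ D.toSubmodule :=
    fun u hu v hv => D.lie_mem hu hv
  rw [he.quantity_eq_sum_adForm (i := 4) (j := 4) (k := 4) hmem,
    (isInvariantForm_adForm hD hmem).sum_rotation hM.frame le_rfl hM.span_D hM.B_l hD,
    hM.frame.adForm_self hM.span_D hM.B_l hD]
  norm_num

theorem quantity_A_m_m (a i : Fin 3) : quantity e (a.succ.castAdd 4) (i.natAdd 5) (i.natAdd 5) =
    3 / 72 * adForm (e (i.natAdd 5)) (x a) (x a) := by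
  rw [he.quantity_eq_sum_adForm,
    (h.isInvariantForm_adForm_m he i).sum_triple (hM.triple a) (A_le_isotropy A D a) (hM.span_A a)
      (hM.B_x a) (isOrthonormalBasis_A he a)]
  rw [summand_succ_castAdd, summand_natAdd]
  exact fun u hu => h.invariant i u (A_le_isotropy A D a hu)

/-- The form is evaluated at `l 0 1 + l 2 3`, for which the cubic relation is available. Its value
there is twice that at `l 0 1`, so 28/36 becomes 14/36. -/
theorem quantity_D_m_m (i : Fin 3) : quantity e 4 (i.natAdd 5) (i.natAdd 5) =
    14 / 36 * adForm (e (i.natAdd 5)) (l 0 1 + l 2 3) (l 0 1 + l 2 3) := by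
  have hl : ∀ i j, l i j ∈ isotropy A D := fun i j =>
    D_le_isotropy A D (hM.span_D.le (Submodule.subset_span ⟨(i, j), rfl⟩))
  rw [he.quantity_eq_sum_adForm,
    (h.isInvariantForm_adForm_m he i).sum_rotation hM.frame (D_le_isotropy A D) hM.span_D
      hM.B_l (isOrthonormalBasis_D he), (h.isInvariantForm_adForm_m he i).rotation_add hM.frame hl]
  · ring
  · decide
  · decide
  · decide
  · decide
  · decide
  rw [summand_natAdd]
  exact fun u hu => h.invariant i u (D_le_isotropy A D hu)

/-- When the action is nontrivial, ad `x a` is skew with square -1 on `m i`, hence an isometry, and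
each basis vector contributes 1. -/
theorem exists_adForm_x_eq (a i : Fin 3) : ∃ n : ℕ, n ≤ 1 ∧
    (n = 0 ↔ ∀ u ∈ A a, ∀ v ∈ m i, ⁅u, v⁆ = 0) ∧
    adForm (e (i.natAdd 5)) (x a) (x a) = n * d (i.natAdd 5) := by
  have hm := isOrthonormalBasis_m he i
  have hx : x a ∈ A a := (hM.span_A a).le (Submodule.subset_span (by simp))
  rcases h.lie_eq_zero_or_lie_lie_eq_neg hM a i with h0 | h1
  · refine ⟨0, zero_le_one, by simpa using h0, ?_⟩
    rw [adForm_eq_zero fun α => h0 _ hx _ (hm.mem α)]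
    simp
  · refine ⟨1, le_rfl, ⟨fun h => absurd h one_ne_zero, fun h0 => absurd ?_ (h.ne_bot i)⟩, ?_⟩
    · rw [Submodule.eq_bot_iff]
      intro v hv
      rw [← neg_eq_zero, ← h1 v hv, h0 _ hx v hv, lie_zero]
    · have h2 : ∀ α, B ⁅x a, e (i.natAdd 5) α⁆ ⁅x a, e (i.natAdd 5) α⁆ = 1 := by
        intro α
        rw [B_lie_skew, h1 _ (hm.mem α), B_neg_right, neg_neg, hm.orthonormal, if_pos rfl]
      rw [adForm_apply, Finset.sum_congr rfl fun α _ => h2 α]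
      simp

/-- Of the total B(x, x) = 72, the ideal `A a` itself accounts for 8 and the other ideals for
nothing. -/
theorem sum_adForm_x (a : Fin 3) : ∑ i : Fin 3, adForm (e (i.natAdd 5)) (x a) (x a) = 64 := by
  have hx : x a ∈ A a := (hM.span_A a).le (Submodule.subset_span (by simp))
  have h1 := he.B_self_eq_sum (fun i j hij => h.orthogonal_summand hM hij) h.iSup_summand (x a)
  have h2 : ∀ b ≠ a, adForm (e (b.succ.castAdd 4)) (x a) (x a) = 0 := fun b hb =>
    adForm_eq_zero fun α => h.lie_A_A a b hb.symm _ hx _ ((isOrthonormalBasis_A he b).mem α)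
  have h3 : ∑ b : Fin 3, adForm (e (b.succ.castAdd 4)) (x a) (x a) = 8 := by
    rw [Fintype.sum_eq_single a h2,
      (hM.triple a).adForm_self (hM.span_A a) (hM.B_x a) (isOrthonormalBasis_A he a)]
  have h4 : adForm (e 4) (x a) (x a) = 0 :=
    adForm_eq_zero fun α => h.lie_A_D a _ hx _ ((isOrthonormalBasis_D he).mem α)
  have h5 : adForm (e 0) (x a) (x a) = 0 := adForm_eq_zero fun α => by
    rw [(Submodule.mem_bot ℝ).mp ((he.isOrthonormalBasis 0).mem α), lie_zero]
  rw [Fin.sum_univ_three] at h3 ⊢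
  change adForm (e 1) _ _ + adForm (e 2) _ _ + adForm (e 3) _ _ = 8 at h3
  change adForm (e 5) _ _ + adForm (e 6) _ _ + adForm (e 7) _ _ = 64
  rw [hM.B_x, Fin.sum_univ_eight, h4, h5] at h1
  linarith

/-- Of the total 72, the ideal `D` accounts for 2 · 12 and the `A a` for nothing. -/
theorem sum_adForm_l :
    ∑ i : Fin 3, adForm (e (i.natAdd 5)) (l 0 1 + l 2 3) (l 0 1 + l 2 3) = 48 := by
  set w := l 0 1 + l 2 3 with hw
  have hl : ∀ i j, l i j ∈ D := fun i j => hM.span_D.le (Submodule.subset_span ⟨(i, j), rfl⟩)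
  have hwD : w ∈ D := add_mem (hl 0 1) (hl 2 3)
  have hD := isOrthonormalBasis_D he
  have h1 := he.B_self_eq_sum (fun i j hij => h.orthogonal_summand hM hij) h.iSup_summand w
  have h2 : ∀ b : Fin 3, adForm (e (b.succ.castAdd 4)) w w = 0 := fun b =>
    adForm_eq_zero fun α => by
      rw [← lie_skew, h.lie_A_D b _ ((isOrthonormalBasis_A he b).mem α) _ hwD, neg_zero]
  have h4 : adForm (e 4) w w = 24 := by
    rw [hw, (isInvariantForm_adForm hD fun u hu v hv => D.lie_mem hu hv).rotation_add hM.frame hl,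
      hM.frame.adForm_self hM.span_D hM.B_l hD]
    · norm_num
    all_goals decide
  have h5 : adForm (e 0) w w = 0 := adForm_eq_zero fun α => by
    rw [(Submodule.mem_bot ℝ).mp ((he.isOrthonormalBasis 0).mem α), lie_zero]
  have h6 : B w w = 72 := by
    have := isInvariantForm_B.rotation_add (g := g) hM.frame (fun _ _ => Submodule.mem_top)
      (i := 0) (j := 1) (k := 2) (m := 3) (by decide) (by decide) (by decide) (by decide)
      (by decide)
    change B _ _ = 2 * B _ _ at this
    rw [hw, this, hM.B_l]
    norm_num
  have h7 : adForm (e 1) w w = 0 := h2 0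
  have h8 : adForm (e 2) w w = 0 := h2 1
  have h9 : adForm (e 3) w w = 0 := h2 2
  rw [Fin.sum_univ_three]
  change adForm (e 5) _ _ + adForm (e 6) _ _ + adForm (e 7) _ _ = 48
  rw [h6, Fin.sum_univ_eight, h4, h5, h7, h8, h9] at h1
  linarith

theorem exists_adForm_l_eq (i : Fin 3) :
    ∃ n : ℕ, adForm (e (i.natAdd 5)) (l 0 1 + l 2 3) (l 0 1 + l 2 3) = n := by
  have hl : ∀ i j, l i j ∈ isotropy A D := fun i j =>
    D_le_isotropy A D (hM.span_D.le (Submodule.subset_span ⟨(i, j), rfl⟩))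
  exact (isOrthonormalBasis_m he i).exists_nat_adForm_eq
    (h.invariant i _ (add_mem (hl 0 1) (hl 2 3))) (hM.cubed_l i)

end IsDecomposition

end E7I

/-! ### Support of the bracket sums and the dimension identity -/

namespace E7I

variable {g : Type*} [LieRing g] [LieAlgebra ℝ g]

theorem quantity_eq_zero_of_multiset_eq {d : Fin 8 → ℕ} {e : (i : Fin 8) → Fin (d i) → g}
    {a : Fin 3} (ha : quantity e (a.succ.castAdd 4) (a.natAdd 5) (a.natAdd 5) = 0) {i j k : Fin 8}
    (h : ({i, j, k} : Multiset (Fin 8)) = {a.succ.castAdd 4, a.natAdd 5, a.natAdd 5}) :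
    quantity e i j k = 0 := by
  have key : ∀ (a : Fin 3) (i j k : Fin 8),
      ({i, j, k} : Multiset (Fin 8)) = {a.succ.castAdd 4, a.natAdd 5, a.natAdd 5} →
      (i = a.succ.castAdd 4 ∧ j = a.natAdd 5 ∧ k = a.natAdd 5) ∨
      (i = a.natAdd 5 ∧ j = a.succ.castAdd 4 ∧ k = a.natAdd 5) ∨
      (i = a.natAdd 5 ∧ j = a.natAdd 5 ∧ k = a.succ.castAdd 4) := by
    decide +kernel
  rcases key a i j k h with ⟨rfl, rfl, rfl⟩ | ⟨rfl, rfl, rfl⟩ | ⟨rfl, rfl, rfl⟩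
  · exact ha
  · rwa [quantity_swap_left]
  · rwa [quantity_swap_right, quantity_swap_left]

namespace IsDecomposition

variable [FiniteDimensional ℝ g] {A : Fin 3 → LieSubalgebra ℝ g} {D : LieSubalgebra ℝ g}
  {m : Fin 3 → Submodule ℝ g} (h : IsDecomposition A D m) {d : Fin 8 → ℕ}
  {e : (i : Fin 8) → Fin (d i) → g} (he : IsAdaptedBasis (summand A D m) e)
include h he

theorem multiset_mem_of_quantity_ne_zero {i j k : Fin 8} (hq : quantity e i j k ≠ 0) :
    ({i, j, k} : Multiset (Fin 8)) ∈ admissibleTriples.map fun t => {t.1, t.2.1, t.2.2} := by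
  have key : ∀ {i j k : Fin 8}, i ≤ j → j ≤ k → quantity e i j k ≠ 0 →
      ({i, j, k} : Multiset (Fin 8)) ∈ admissibleTriples.map fun t => {t.1, t.2.1, t.2.2} :=
    fun hij hjk hq => List.mem_map.mpr
      ⟨_, by_contra fun hn => hq (h.quantity_eq_zero_of_notMem he hij hjk hn), rfl⟩
  have hl : ∀ i j k : Fin 8, ({i, j, k} : Multiset (Fin 8)) = {j, i, k} := fun i j k =>
    Multiset.cons_swap i j {k}
  have hr : ∀ i j k : Fin 8, ({i, j, k} : Multiset (Fin 8)) = {i, k, j} := fun i j k =>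
    congrArg (i ::ₘ ·) (Multiset.pair_comm j k)
  rcases le_total i j with hij | hij <;> rcases le_total j k with hjk | hjk <;>
    rcases le_total i k with hik | hik
  · exact key hij hjk hq
  · exact key hij hjk hq
  · rw [quantity_swap_right] at hq
    rw [hr]
    exact key hik hjk hq
  · rw [quantity_swap_right, quantity_swap_left] at hq
    rw [hr, hl]
    exact key hik hij hq
  · rw [quantity_swap_left] at hq
    rw [hl]
    exact key hij hik hq
  · rw [quantity_swap_left, quantity_swap_right] at hq
    rw [hl, hr]
    exact key hjk hik hq
  · rw [quantity_swap_left, quantity_swap_right, quantity_swap_left] at hq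
    rw [hl, hr, hl]
    exact key hjk hij hq
  · rw [quantity_swap_left, quantity_swap_right, quantity_swap_left] at hq
    rw [hl, hr, hl]
    exact key hjk hij hq

/-- This is the sum rule at an m-index. Five admissible triples contain that index, and each occurs
for two ordered pairs of the remaining indices; hence the factor 2 and the ten pairs in `S`. -/
theorem dim_m_eq {x y z : Fin 3 → g} {l : Fin 8 → Fin 8 → g} (hM : IsModel A D m x y z l)
    (i : Fin 3) : (d (i.natAdd 5) : ℝ) =
      2 * (∑ a : Fin 3, quantity e (a.succ.castAdd 4) (i.natAdd 5) (i.natAdd 5) +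
        quantity e 4 (i.natAdd 5) (i.natAdd 5) + quantity e 5 6 7) := by
  rw [← he.sum_quantity (fun i j hij => h.orthogonal_summand hM hij) h.iSup_summand,
    ← Fintype.sum_prod_type']
  let S : Fin 3 → List (Fin 8 × Fin 8) := fun i =>
    [(1, i.natAdd 5), (i.natAdd 5, 1), (2, i.natAdd 5), (i.natAdd 5, 2), (3, i.natAdd 5),
      (i.natAdd 5, 3), (4, i.natAdd 5), (i.natAdd 5, 4), ((i + 1).natAdd 5, (i + 2).natAdd 5),
      ((i + 2).natAdd 5, (i + 1).natAdd 5)]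
  have hS : ∀ (i : Fin 3) (p : Fin 8 × Fin 8),
      ({i.natAdd 5, p.1, p.2} : Multiset (Fin 8)) ∈
        admissibleTriples.map (fun t => ({t.1, t.2.1, t.2.2} : Multiset (Fin 8))) → p ∈ S i := by
    decide +kernel
  have hS' : ∀ i, (S i).Nodup := by decide +kernel
  have hsum : ∑ p : Fin 8 × Fin 8, quantity e (i.natAdd 5) p.1 p.2 =
      ((S i).map fun p => quantity e (i.natAdd 5) p.1 p.2).sum := by
    rw [← List.sum_toFinset _ (hS' i)]
    refine (Finset.sum_subset (Finset.subset_univ _) fun p _ hp => ?_).symm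
    by_contra hq
    exact hp (List.mem_toFinset.mpr (hS i p (h.multiset_mem_of_quantity_ne_zero he hq)))
  have hl : ∀ a b, quantity e b a b = quantity e a b b := fun a b => quantity_swap_left e b a b
  have hr : ∀ a b, quantity e b b a = quantity e a b b := fun a b => by
    rw [quantity_swap_right, quantity_swap_left]
  have h576 : quantity e 5 7 6 = quantity e 5 6 7 := quantity_swap_right e 5 7 6
  have h657 : quantity e 6 5 7 = quantity e 5 6 7 := quantity_swap_left e 6 5 7
  have h675 : quantity e 6 7 5 = quantity e 5 6 7 := by rw [quantity_swap_right, h657]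
  have h756 : quantity e 7 5 6 = quantity e 5 6 7 := by rw [quantity_swap_left, h576]
  have h765 : quantity e 7 6 5 = quantity e 5 6 7 := by rw [quantity_swap_right, h756]
  rw [hsum, Fin.sum_univ_three]
  have h5 : (S 0).map (fun p => quantity e 5 p.1 p.2) =
    [quantity e 5 1 5, quantity e 5 5 1, quantity e 5 2 5, quantity e 5 5 2, quantity e 5 3 5,
      quantity e 5 5 3, quantity e 5 4 5, quantity e 5 5 4, quantity e 5 6 7, quantity e 5 7 6] :=
    rfl
  have h6 : (S 1).map (fun p => quantity e 6 p.1 p.2) =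
    [quantity e 6 1 6, quantity e 6 6 1, quantity e 6 2 6, quantity e 6 6 2, quantity e 6 3 6,
      quantity e 6 6 3, quantity e 6 4 6, quantity e 6 6 4, quantity e 6 7 5, quantity e 6 5 7] :=
    rfl
  have h7 : (S 2).map (fun p => quantity e 7 p.1 p.2) =
    [quantity e 7 1 7, quantity e 7 7 1, quantity e 7 2 7, quantity e 7 7 2, quantity e 7 3 7,
      quantity e 7 7 3, quantity e 7 4 7, quantity e 7 7 4, quantity e 7 5 6, quantity e 7 6 5] :=
    rfl
  fin_cases i
  · change ((S 0).map fun p => quantity e 5 p.1 p.2).sum = 2 * (quantity e 1 5 5 +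
      quantity e 2 5 5 + quantity e 3 5 5 + quantity e 4 5 5 + quantity e 5 6 7)
    rw [h5]
    simp only [List.sum_cons, List.sum_nil, hl, hr, h576]
    ring
  · change ((S 1).map fun p => quantity e 6 p.1 p.2).sum = 2 * (quantity e 1 6 6 +
      quantity e 2 6 6 + quantity e 3 6 6 + quantity e 4 6 6 + quantity e 5 6 7)
    rw [h6]
    simp only [List.sum_cons, List.sum_nil, hl, hr, h657, h675]
    ring
  · change ((S 2).map fun p => quantity e 7 p.1 p.2).sum = 2 * (quantity e 1 7 7 +
      quantity e 2 7 7 + quantity e 3 7 7 + quantity e 4 7 7 + quantity e 5 6 7)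
    rw [h7]
    simp only [List.sum_cons, List.sum_nil, hl, hr, h756, h765]
    ring

end IsDecomposition

end E7I

/-! ### Arithmetic of the dimensions, numbering of the ideals, conclusion -/

namespace E7I

/-- With s the sum of column i of `ε`, `hτ` reads (1 - 3s) n_i ≡ 1 mod 7. Thus n_i = 32 forces s = 2
and n_i = 64 forces s = 0. -/
theorem dimensions_eq_of_spin_pattern {ε : Fin 3 → Fin 3 → ℕ} {n τ : Fin 3 → ℕ}
    (hε : ∀ a i, ε a i ≤ 1) (hn : ∀ i, 0 < n i) (hsum : n 0 + n 1 + n 2 = 96)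
    (hrow : ∀ a, ε a 0 * n 0 + ε a 1 * n 1 + ε a 2 * n 2 = 64)
    (hτ : ∀ i, 28 * τ i + 512 + 3 * (ε 0 i * n i + ε 1 i * n i + ε 2 i * n i) = 36 * n i) :
    (∀ i, n i = 32) ∧ ∀ i, ε 0 i + ε 1 i + ε 2 i = 2 := by
  have hcases : ∀ a i, ε a i = 0 ∨ ε a i = 1 := fun a i => by have := hε a i; omega
  have hcol : ∀ i, (n i = 32 → ε 0 i + ε 1 i + ε 2 i = 2) ∧
      (n i = 64 → ε 0 i + ε 1 i + ε 2 i = 0) := by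
    intro i
    have h := hτ i
    rcases hcases 0 i with e0 | e0 <;> rcases hcases 1 i with e1 | e1 <;>
      rcases hcases 2 i with e2 | e2 <;> rw [e0, e1, e2] at h ⊢ <;> omega
  have hcol64 : ∀ i, n i = 64 → ∀ a, ε a i = 0 := by
    intro i hi a
    have := (hcol i).2 hi
    fin_cases a <;> simp only [Fin.zero_eta, Fin.mk_one, Fin.reduceFinMk] <;> omega
  -- The inactive dimensions of a row sum to 96 - 64 = 32. A single active entry would have
  -- dimension 64, which makes its column zero; so exactly one entry is inactive, of dimension 32.
  -- Its column contains no second zero, so the three rows have different inactive columns.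
  have hrow' : ∀ a, (ε a 0 = 0 ∧ ε a 1 = 1 ∧ ε a 2 = 1 ∧ n 0 = 32) ∨
      (ε a 0 = 1 ∧ ε a 1 = 0 ∧ ε a 2 = 1 ∧ n 1 = 32) ∨
      (ε a 0 = 1 ∧ ε a 1 = 1 ∧ ε a 2 = 0 ∧ n 2 = 32) := by
    intro a
    have h := hrow a
    have h0 := hn 0
    have h1 := hn 1
    have h2 := hn 2
    have h3 := fun i hi => hcol64 i hi a
    have h30 := h3 0
    have h31 := h3 1
    have h32 := h3 2
    rcases hcases a 0 with e0 | e0 <;> rcases hcases a 1 with e1 | e1 <;>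
      rcases hcases a 2 with e2 | e2 <;> rw [e0, e1, e2] at h <;> omega
  have h0 := (hcol 0).1
  have h1 := (hcol 1).1
  have h2 := (hcol 2).1
  suffices (n 0 = 32 ∧ n 1 = 32 ∧ n 2 = 32) ∧ ε 0 0 + ε 1 0 + ε 2 0 = 2 ∧
      ε 0 1 + ε 1 1 + ε 2 1 = 2 ∧ ε 0 2 + ε 1 2 + ε 2 2 = 2 by
    refine ⟨fun i => ?_, fun i => ?_⟩ <;> fin_cases i <;> simp [this]
  clear hrow hτ hcol hcol64 hcases
  rcases hrow' 0 with e | e | e <;> rcases hrow' 1 with f | f | f <;>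
    rcases hrow' 2 with k | k | k <;> omega

/-- Each row and each column has exactly one zero, so the zeros form a permutation matrix. -/
theorem exists_perm_of_spin_pattern {ε : Fin 3 → Fin 3 → ℕ} (hε : ∀ a i, ε a i ≤ 1)
    (hrow : ∀ a, ε a 0 + ε a 1 + ε a 2 = 2) (hcol : ∀ i, ε 0 i + ε 1 i + ε 2 i = 2) :
    ∃ σ : Equiv.Perm (Fin 3), ∀ a i, ε (σ a) i = 0 ↔ a = i := by
  have key : ∀ f : Fin 3 → Fin 3 → Fin 2, (∀ a, (f a 0 : ℕ) + f a 1 + f a 2 = 2) →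
      (∀ i, (f 0 i : ℕ) + f 1 i + f 2 i = 2) →
      ∃ σ : Equiv.Perm (Fin 3), ∀ a i, (f (σ a) i : ℕ) = 0 ↔ a = i := by
    decide +kernel
  exact key (fun a i => ⟨ε a i, Nat.lt_succ_of_le (hε a i)⟩) hrow hcol

theorem exists_isOrthonormalBasis {g : Type*} [LieRing g] [LieAlgebra ℝ g]
    [FiniteDimensional ℝ g] (hB : ∀ x : g, x ≠ 0 → 0 < B x x) (V : Submodule ℝ g) :
    ∃ (n : ℕ) (e : Fin n → g), IsOrthonormalBasis V e := by
  have hsymm : LinearMap.IsSymm ((-killingForm ℝ g).domRestrict₁₂ V V) :=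
    ⟨fun u v => B_comm (u : g) v⟩
  obtain ⟨v, hv⟩ := LinearMap.BilinForm.exists_orthogonal_basis hsymm
  have hpos : ∀ i, 0 < B (v i : g) (v i) := fun i =>
    hB _ fun h0 => v.ne_zero i (Subtype.ext h0)
  refine ⟨_, fun i => (√(B (v i : g) (v i)))⁻¹ • (v i : g), ?_, fun i j => ?_⟩
  · refine Eq.trans ?_ (show Submodule.span ℝ (Set.range fun i => (v i : g)) = V by
      rw [Set.range_comp' Subtype.val v, ← V.coe_subtype, ← Submodule.map_span, v.span_eq,
        Submodule.map_top, Submodule.range_subtype])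
    apply le_antisymm <;> rw [Submodule.span_le] <;> rintro _ ⟨i, rfl⟩
    · exact Submodule.smul_mem _ _ (Submodule.subset_span ⟨i, rfl⟩)
    · have h2 := Submodule.smul_mem _ (√(B (v i : g) (v i))) (Submodule.subset_span
        (Set.mem_range_self (f := fun i => (√(B (v i : g) (v i)))⁻¹ • (v i : g)) i))
      rwa [smul_inv_smul₀ (Real.sqrt_pos.mpr (hpos i)).ne'] at h2
  · rw [B_smul_left, B_smul_right]
    split_ifs with hij
    · subst hij
      rw [← mul_assoc, ← mul_inv, Real.mul_self_sqrt (hpos i).le, inv_mul_cancel₀ (hpos i).ne']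
    · rw [show B (v i : g) (v j) = 0 from hv hij, mul_zero, mul_zero]

variable {g : Type*} [LieRing g] [LieAlgebra ℝ g] [FiniteDimensional ℝ g]
  {A : Fin 3 → LieSubalgebra ℝ g} {D : LieSubalgebra ℝ g} {m : Fin 3 → Submodule ℝ g}

namespace IsDecomposition

theorem perm (h : IsDecomposition A D m) (σ : Equiv.Perm (Fin 3)) :
    IsDecomposition (fun a => A (σ a)) D m := by
  have hk : isotropy (fun a => A (σ a)) D = isotropy A D := by
    rw [isotropy, isotropy, σ.iSup_comp (g := fun a => (A a).toSubmodule)]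
  exact
    { compact := h.compact
      type_E7 := h.type_E7
      A_iso := fun i => h.A_iso (σ i)
      D_iso := h.D_iso
      lie_A_A := fun i j hij => h.lie_A_A (σ i) (σ j) (σ.injective.ne hij)
      lie_A_D := fun i => h.lie_A_D (σ i)
      sup_eq_top := hk ▸ h.sup_eq_top
      orth_isotropy := hk ▸ h.orth_isotropy
      orth_m := h.orth_m
      invariant := hk ▸ h.invariant
      ne_bot := h.ne_bot
      irreducible := hk ▸ h.irreducible
      lie_self := hk ▸ h.lie_self
      lie_ne := h.lie_ne }

variable (h : IsDecomposition A D m) {d : Fin 8 → ℕ} {e : (i : Fin 8) → Fin (d i) → g}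
  (he : IsAdaptedBasis (summand A D m) e)
include h he

/-- The Casimir constants of the isotropy summands, together with the numbers `ε a i ∈ {0, 1}` that
tell whether `A a` acts nontrivially on `m i`. -/
theorem exists_spin_pattern : ∃ ε : Fin 3 → Fin 3 → ℕ,
    (∀ a i, ε a i ≤ 1) ∧ (∀ a i, ε a i = 0 ↔ ∀ u ∈ A a, ∀ v ∈ m i, ⁅u, v⁆ = 0) ∧
    (∀ a, ε a 0 + ε a 1 + ε a 2 = 2) ∧ (∀ i, ε 0 i + ε 1 i + ε 2 i = 2) ∧
    (∀ a i : Fin 3,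
      quantity e (a.succ.castAdd 4) (i.natAdd 5) (i.natAdd 5) = 4 / 3 * ε a i) ∧
    (∀ i : Fin 3, quantity e 4 (i.natAdd 5) (i.natAdd 5) = 56 / 9) ∧
    quantity e 5 6 7 = 64 / 9 := by
  obtain ⟨x, y, z, l, hM⟩ := h.exists_isModel
  choose ε hε1 hε0 hε using h.exists_adForm_x_eq he hM
  choose τ hτ using h.exists_adForm_l_eq he hM
  have hA : ∀ a i : Fin 3, quantity e (a.succ.castAdd 4) (i.natAdd 5) (i.natAdd 5) =
      3 / 72 * (ε a i * d (i.natAdd 5)) := fun a i => by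
    rw [h.quantity_A_m_m he hM, hε]
  have hD : ∀ i : Fin 3, quantity e 4 (i.natAdd 5) (i.natAdd 5) = 14 / 36 * τ i := fun i => by
    rw [h.quantity_D_m_m he hM, hτ]
  have hrow := fun a => h.sum_adForm_x he hM a
  have hsumτ := h.sum_adForm_l he hM
  have hd := fun i => h.dim_m_eq he hM i
  simp only [hε, hτ, Fin.sum_univ_three] at hrow hsumτ
  simp only [hA, hD, Fin.sum_univ_three] at hd
  let n : Fin 3 → ℕ := fun i => d (i.natAdd 5)
  have hsum : n 0 + n 1 + n 2 = 96 := h.sum_dim_m he hM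
  have hsum' : (n 0 : ℝ) + n 1 + n 2 = 96 := by exact_mod_cast hsum
  change ∀ a, (ε a 0 : ℝ) * n 0 + ε a 1 * n 1 + ε a 2 * n 2 = 64 at hrow
  change ∀ i, (n i : ℝ) = 2 * (3 / 72 * (ε 0 i * n i) + 3 / 72 * (ε 1 i * n i) +
    3 / 72 * (ε 2 i * n i) + 14 / 36 * τ i + quantity e 5 6 7) at hd
  -- Adding the three dimension identities eliminates the individual ε and τ: 96 = 2(3/72 · 192 +
  -- 14/36 · 48 + 3 (567)).
  have h567 : quantity e 5 6 7 = 64 / 9 := by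
    linarith [hd 0, hd 1, hd 2, hrow 0, hrow 1, hrow 2]
  obtain ⟨h32, hcol⟩ := dimensions_eq_of_spin_pattern (n := n) (τ := τ) hε1
    (h.dim_m_pos he) hsum
    (fun a => by exact_mod_cast hrow a) fun i => by
      have : (28 : ℝ) * τ i + 512 + 3 * (ε 0 i * n i + ε 1 i * n i + ε 2 i * n i) = 36 * n i := by
        linarith [hd i]
      exact_mod_cast this
  have h32' : ∀ i, (n i : ℝ) = 32 := fun i => by rw [h32]; norm_num
  refine ⟨ε, hε1, hε0, fun a => ?_, hcol, fun a i => ?_, fun i => ?_, h567⟩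
  · have := hrow a
    rw [h32', h32', h32'] at this
    have h2 : (ε a 0 : ℝ) + ε a 1 + ε a 2 = 2 := by linarith
    exact_mod_cast h2
  · rw [hA]
    change _ * (_ * (n i : ℝ)) = _
    rw [h32']
    ring
  · have h1 := hd i
    have h2 : (ε 0 i : ℝ) + ε 1 i + ε 2 i = 2 := by exact_mod_cast hcol i
    rw [hD]
    rw [h32', h567] at h1
    linarith

omit he in
theorem exists_isAdaptedBasis : ∃ (d : Fin 8 → ℕ) (e : (i : Fin 8) → Fin (d i) → g),
    IsAdaptedBasis (summand A D m) e := by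
  choose d e he using fun i => exists_isOrthonormalBasis h.compact (summand A D m i)
  exact ⟨d, e, fun i => (he i).span_eq, fun i => (he i).orthonormal⟩

omit he in
/-- The three ideals of type `A₁` can be numbered so that the `a`-th one acts trivially on `m i` if
and only if `a = i`. -/
theorem exists_perm_lie_eq_zero_iff : ∃ σ : Equiv.Perm (Fin 3),
    ∀ a i, (∀ u ∈ A (σ a), ∀ v ∈ m i, ⁅u, v⁆ = 0) ↔ a = i := by
  -- Which ideal kills which summand does not depend on a basis, so one auxiliary basis fixes σ
  -- before any basis is given.
  obtain ⟨d, e, he⟩ := h.exists_isAdaptedBasis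
  obtain ⟨ε, hε1, hε0, hrow, hcol, -⟩ := h.exists_spin_pattern he
  obtain ⟨σ, hσ⟩ := exists_perm_of_spin_pattern hε1 hrow hcol
  exact ⟨σ, fun a i => (hε0 (σ a) i).symm.trans (hσ a i)⟩

theorem quantity_eq_of_lie_eq_zero (hpat : ∀ a i, (∀ u ∈ A a, ∀ v ∈ m i, ⁅u, v⁆ = 0) ↔ a = i) :
    (quantity e 1 1 1 = 1 / 3 ∧ quantity e 2 2 2 = 1 / 3 ∧ quantity e 3 3 3 = 1 / 3) ∧
    quantity e 4 4 4 = 28 / 3 ∧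
    quantity e 5 6 7 = 64 / 9 ∧
    (quantity e 1 6 6 = 4 / 3 ∧ quantity e 1 7 7 = 4 / 3 ∧ quantity e 2 5 5 = 4 / 3 ∧
      quantity e 2 7 7 = 4 / 3 ∧ quantity e 3 5 5 = 4 / 3 ∧ quantity e 3 6 6 = 4 / 3) ∧
    (quantity e 1 5 5 = 0 ∧ quantity e 2 6 6 = 0 ∧ quantity e 3 7 7 = 0) ∧
    (quantity e 4 5 5 = 56 / 9 ∧ quantity e 4 6 6 = 56 / 9 ∧ quantity e 4 7 7 = 56 / 9) ∧
    ∀ i j k : Fin 8, quantity e i j k ≠ 0 →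
      ({i, j, k} : Multiset (Fin 8)) ∈
        ({{1, 1, 1}, {2, 2, 2}, {3, 3, 3}, {4, 4, 4}, {5, 6, 7},
          {1, 6, 6}, {1, 7, 7}, {2, 5, 5}, {2, 7, 7}, {3, 5, 5}, {3, 6, 6},
          {4, 5, 5}, {4, 6, 6}, {4, 7, 7}} : Set (Multiset (Fin 8))) := by
  obtain ⟨x, y, z, l, hM⟩ := h.exists_isModel
  obtain ⟨ε, hε1, hε0, -, -, hA, hD, h567⟩ := h.exists_spin_pattern he
  have hA1 : ∀ a i : Fin 3, a ≠ i →
      quantity e (a.succ.castAdd 4) (i.natAdd 5) (i.natAdd 5) = 4 / 3 := fun a i hai => by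
    have h0 : ε a i ≠ 0 := fun h0 => hai ((hpat a i).mp ((hε0 a i).mp h0))
    have h1 : ε a i = 1 := by have := hε1 a i; omega
    rw [hA, h1]
    norm_num
  have hA0 : ∀ a : Fin 3, quantity e (a.succ.castAdd 4) (a.natAdd 5) (a.natAdd 5) = 0 := fun a => by
    rw [hA, (hε0 a a).mpr ((hpat a a).mpr rfl)]
    norm_num
  refine ⟨⟨quantity_A_A_A he hM 0, quantity_A_A_A he hM 1, quantity_A_A_A he hM 2⟩,
    quantity_D_D_D he hM, h567,
    ⟨hA1 0 1 (by decide), hA1 0 2 (by decide), hA1 1 0 (by decide), hA1 1 2 (by decide),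
      hA1 2 0 (by decide), hA1 2 1 (by decide)⟩, ⟨hA0 0, hA0 1, hA0 2⟩, ⟨hD 0, hD 1, hD 2⟩,
    fun i j k hq => ?_⟩
  have hmem := h.multiset_mem_of_quantity_ne_zero he hq
  have hne : ∀ a : Fin 3,
      ({i, j, k} : Multiset (Fin 8)) ≠ {a.succ.castAdd 4, a.natAdd 5, a.natAdd 5} :=
    fun a ha => hq (quantity_eq_zero_of_multiset_eq (hA0 a) ha)
  have h0 : ({i, j, k} : Multiset (Fin 8)) ≠ {1, 5, 5} := hne 0
  have h1 : ({i, j, k} : Multiset (Fin 8)) ≠ {2, 6, 6} := hne 1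
  have h2 : ({i, j, k} : Multiset (Fin 8)) ≠ {3, 7, 7} := hne 2
  generalize ({i, j, k} : Multiset (Fin 8)) = s at hmem h0 h1 h2 ⊢
  simp only [admissibleTriples, List.map_cons, List.map_nil, List.mem_cons, List.not_mem_nil,
    or_false] at hmem
  simp only [Set.mem_insert_iff, Set.mem_singleton_iff]
  tauto

end IsDecomposition

end E7I

theorem lemma3p4 {g : Type*} [LieRing g] [LieAlgebra ℝ g] [FiniteDimensional ℝ g]
    (A : Fin 3 → LieSubalgebra ℝ g) (D : LieSubalgebra ℝ g) (m : Fin 3 → Submodule ℝ g)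
    (h : E7I.IsDecomposition A D m) :
    ∃ σ : Equiv.Perm (Fin 3), ∀ (d : Fin 8 → ℕ) (e : (i : Fin 8) → Fin (d i) → g),
      E7I.IsAdaptedBasis (E7I.summand (fun i => A (σ i)) D m) e →
      (E7I.quantity e 1 1 1 = 1 / 3 ∧ E7I.quantity e 2 2 2 = 1 / 3 ∧
        E7I.quantity e 3 3 3 = 1 / 3) ∧
      E7I.quantity e 4 4 4 = 28 / 3 ∧
      E7I.quantity e 5 6 7 = 64 / 9 ∧
      (E7I.quantity e 1 6 6 = 4 / 3 ∧ E7I.quantity e 1 7 7 = 4 / 3 ∧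
        E7I.quantity e 2 5 5 = 4 / 3 ∧ E7I.quantity e 2 7 7 = 4 / 3 ∧
        E7I.quantity e 3 5 5 = 4 / 3 ∧ E7I.quantity e 3 6 6 = 4 / 3) ∧
      (E7I.quantity e 1 5 5 = 0 ∧ E7I.quantity e 2 6 6 = 0 ∧ E7I.quantity e 3 7 7 = 0) ∧
      (E7I.quantity e 4 5 5 = 56 / 9 ∧ E7I.quantity e 4 6 6 = 56 / 9 ∧
        E7I.quantity e 4 7 7 = 56 / 9) ∧
      ∀ i j k : Fin 8, E7I.quantity e i j k ≠ 0 →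
        ({i, j, k} : Multiset (Fin 8)) ∈
          ({{1, 1, 1}, {2, 2, 2}, {3, 3, 3}, {4, 4, 4}, {5, 6, 7},
            {1, 6, 6}, {1, 7, 7}, {2, 5, 5}, {2, 7, 7}, {3, 5, 5}, {3, 6, 6},
            {4, 5, 5}, {4, 6, 6}, {4, 7, 7}} : Set (Multiset (Fin 8))) := by
  obtain ⟨σ, hσ⟩ := h.exists_perm_lie_eq_zero_iff
  exact ⟨σ, fun d e he => (h.perm σ).quantity_eq_of_lie_eq_zero he hσ⟩
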